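/- Fix a prime $p$. For a finite $p$-group $G$ the breadth $\mathrm{br}(G)$ is the largest integer $b$ such that $G$ has a conjugacy class of size $p^b$, and the representation exponent $\mathrm{rexp}(G)$ is defined by $p^{\mathrm{rexp}(G)}=\max\{\chi(1) : \chi\in\mathrm{Irr}(G)\}$, where $\mathrm{Irr}(G)$ is the set of irreducible complex characters of $G$. The group $G$ has breadth-degree type $(b,d)$ if $b=\mathrm{br}(G)$ and $d=\mathrm{rexp}(G)$, and it is stem if $Z(G)\le G'$. Let $\sigma(b,d)\in\mathbb{N}\cup\{\infty\}$ be the supremum of the orders $|G|$ of the finite stem $p$-groups $G$ of breadth-degree type $(b',d')$ with $b'\le b$ and $d'\le d$. Then the following hold. 1. $\sigma(b,d)\ge p^{b+2d}$ for all $b,d\ge 1$. Consequently $\sup_{s\ge 1}\sigma(s,d)=\infty$ for every $d\ge 1$, and $\sup_{t\ge 1}\sigma(b,t)=\infty$ for every $b\ge 1$. 2. Let $\theta\neq 1$ be a $p$-th root of unity, let $H=\mathbb{Z}_p[\theta]$ (as an additive group), let $g$ be the automorphism of $H$ given by multiplication by $\theta$, let $M_\infty=\langle g\rangle\ltimes H$,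 and let $M_i=M_\infty/\gamma_i(M_\infty)$. For every $i\ge 3$ the group $M_i$ is a stem $p$-group of maximal class (order $p^i$, nilpotency class $i-1$) and has breadth-degree type $(i-2,1)$. 3. Extraspecial groups of order $p^3$ exist. If $1\le d\le b$ and $E_1,\dots,E_{d-1}$ are any extraspecial groups of order $p^3$, then $M_{b-d+3}\times\prod_{j=1}^{d-1}E_j$ is a stem $p$-group of breadth-degree type $(b,d)$ and of order $p^{b+2d}$. 4. If $1\le b<d$ and $UT_3(\mathbb{F}_{p^d})$ is the group of $3\times 3$ upper unitriangular matrices over the field with $p^d$ elements, then its center has a subgroup of order $p^{d-b}$, and for every subgroup $N$ of order $p^{d-b}$ of its center the quotient $UT_3(\mathbb{F}_{p^d})/N$ is a stem $p$-group of breadth-degree type $(b,d)$ and of order $p^{b+2d}$. 5. Let $p$ be odd. For $b\ge 1$ let $F$ be the free group on $b+1$ generators and $\mathcal{F}_{b+1}=F/\gamma_3(F)F^p$, where $F^p$ is the subgroup generated by the $p$-th powers. Then $\mathcal{F}_{b+1}$ is a stem $p$-group of breadth-degree type $\left(b,\lfloor\frac{b+1}{2}\rfloor\right)$ and of order $p^{(b^2+3b+2)/2}$,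 with $\mathcal{F}_{b+1}'=Z(\mathcal{F}_{b+1})$ of order $p^{b(b+1)/2}$. Hence $$\sigma\left(b,\left\lfloor\tfrac{b+1}{2}\right\rfloor\right)\ge p^{(b^2+3b+2)/2}.$$ More generally, for $b,d\ge 1$, one has $\sigma(b,d)\ge p^{(b^2+3b+2)/2}$ if $b\le 2d-1$, and $\sigma(b,d)\ge p^{d(2d+1)}$ if $b\ge 2d$. -/

import Mathlib

/-- A group is stem if its center is contained in its derived subgroup. -/
def IsStem (G : Type*) [Group G] : Prop :=
  Subgroup.center G ≤ commutator G

/-- `b` is the breadth of the finite `p`-group `G`: the largest integer such that some conjugacy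
class of `G` has `p ^ b` elements. -/
def IsBreadth (p : ℕ) (G : Type*) [Group G] (b : ℕ) : Prop :=
  IsGreatest {n : ℕ | ∃ g : G, Nat.card (conjugatesOf g) = p ^ n} b

/-- The set of irreducible complex characters of `G`. Every finite-dimensional complex
representation is isomorphic to one on some `ℂ ^ n`. -/
def Irr (G : Type*) [Group G] : Set (G → ℂ) :=
  {χ | ∃ (n : ℕ) (ρ : Representation ℂ G (Fin n → ℂ)), ρ.IsIrreducible ∧ ρ.character = χ}

/-- `d` is the representation exponent of the finite `p`-group `G`: the largest degree `χ(1)` of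
an irreducible character of `G` is `p ^ d`. -/
def IsRepExponent (p : ℕ) (G : Type*) [Group G] (d : ℕ) : Prop :=
  IsGreatest {m : ℕ | ∃ χ ∈ Irr G, χ 1 = m} (p ^ d)

/-- `G` has breadth-degree type `(b, d)`. -/
def HasBreadthDegreeType (p : ℕ) (G : Type*) [Group G] (b d : ℕ) : Prop :=
  IsBreadth p G b ∧ IsRepExponent p G d

/-- `G` is a finite stem `p`-group of breadth-degree type `(b, d)`. -/
structure IsStemPGroupOfType (p : ℕ) (G : Type*) [Group G] (b d : ℕ) : Prop where
  finite : Finite G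
  isPGroup : IsPGroup p G
  isStem : IsStem G
  hasType : HasBreadthDegreeType p G b d

/-- The size of the breadth-degree type `(b, d)`: the supremum of the orders of the finite stem
`p`-groups of type `(b', d')` with `b' ≤ b` and `d' ≤ d`. -/
noncomputable def sizeOfType (p b d : ℕ) : ℕ∞ :=
  sSup {n : ℕ∞ | ∃ (G : Type) (_ : Group G), ∃ b' ≤ b, ∃ d' ≤ d,
    IsStemPGroupOfType p G b' d' ∧ n = (Nat.card G : ℕ∞)}

/-- A finite `p`-group is extraspecial if its center has order `p` and equals both the derived
subgroup and the Frattini subgroup. -/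
structure IsExtraspecial (p : ℕ) (G : Type*) [Group G] : Prop where
  finite : Finite G
  isPGroup : IsPGroup p G
  card_center : Nat.card (Subgroup.center G) = p
  commutator_eq : commutator G = Subgroup.center G
  frattini_eq : frattini G = Subgroup.center G

/-! The group `ℤ_p[θ] ⋊ C_p` and its quotients by the terms of the lower central series. -/

/-- The ring `ℤ_p[θ]`, where `θ` is a primitive `p`-th root of unity. -/
abbrev ZpTheta (p : ℕ) [Fact p.Prime] : Type := CyclotomicRing p ℤ_[p] ℚ_[p]

/-- The root of unity `θ`, as a unit of `ℤ_p[θ]`. -/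
noncomputable def theta (p : ℕ) [Fact p.Prime] : (ZpTheta p)ˣ :=
  ((IsCyclotomicExtension.zeta_spec p ℤ_[p] (ZpTheta p)).isUnit
    (Fact.out : p.Prime).ne_zero).unit

/-- The automorphism of the additive group `ℤ_p[θ]` (written multiplicatively) given by
multiplication by `θ`. -/
noncomputable def thetaAut (p : ℕ) [Fact p.Prime] : MulAut (Multiplicative (ZpTheta p)) :=
  AddEquiv.toMultiplicative (DistribMulAction.toAddEquiv (ZpTheta p) (theta p))

/-- The semidirect product of the additive group of `ℤ_p[θ]` and the group of automorphisms
generated by multiplication by `θ`. -/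
abbrev MInfty (p : ℕ) [Fact p.Prime] : Type :=
  Multiplicative (ZpTheta p) ⋊[(Subgroup.zpowers (thetaAut p)).subtype]
    Subgroup.zpowers (thetaAut p)

/-- The quotient `M_i = M_∞ / γ_i(M_∞)`, for `i ≥ 1`. In Mathlib's numbering of the lower
central series, the term of index `n` is `γ_{n+1}`. -/
abbrev MQuot (p : ℕ) [Fact p.Prime] (i : ℕ) : Type :=
  MInfty p ⧸ (⊤ : Subgroup (MInfty p)).lowerCentralSeries (i - 1)

/-- The group of upper unitriangular `3 × 3` matrices over a field. -/
def UT3 (K : Type*) [Field K] : Subgroup (GL (Fin 3) K) where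
  carrier := {A | (∀ i j, j < i → A.val i j = 0) ∧ ∀ i, A.val i i = 1}
  one_mem' := by
    refine ⟨fun i j h => ?_, fun i => ?_⟩
    · simp [h.ne']
    · simp
  mul_mem' := by
    rintro A B ⟨hA, hA'⟩ ⟨hB, hB'⟩
    have h1 := hA 1 0 (by decide)
    have h2 := hA 2 0 (by decide)
    have h3 := hA 2 1 (by decide)
    have k1 := hB 1 0 (by decide)
    have k2 := hB 2 0 (by decide)
    have k3 := hB 2 1 (by decide)
    refine ⟨fun i j h => ?_, fun i => ?_⟩
    · fin_cases i <;> fin_cases j <;>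
        simp_all [Matrix.mul_apply, Fin.sum_univ_three]
    · fin_cases i <;> simp_all [Matrix.mul_apply, Fin.sum_univ_three]
  inv_mem' := by
    rintro A ⟨hA, hA'⟩
    have h1 := hA 1 0 (by decide)
    have h2 := hA 2 0 (by decide)
    have h3 := hA 2 1 (by decide)
    have hm : ∀ i j, (A⁻¹.val * A.val) i j = (1 : Matrix (Fin 3) (Fin 3) K) i j := by
      intro i j
      simp
    simp only [Matrix.mul_apply, Fin.sum_univ_three] at hm
    have e00 := hm 0 0
    have e10 := hm 1 0
    have e20 := hm 2 0
    have e11 := hm 1 1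
    have e21 := hm 2 1
    have e22 := hm 2 2
    refine ⟨fun i j h => ?_, fun i => ?_⟩
    · fin_cases i <;> fin_cases j <;> simp_all
    · fin_cases i <;> simp_all

/-- The subgroup `G ^ n` generated by the `n`-th powers of the elements of `G`. -/
def powSubgroup (G : Type*) [Group G] (n : ℕ) : Subgroup G :=
  Subgroup.closure (Set.range fun x : G => x ^ n)

instance powSubgroup_normal (G : Type*) [Group G] (n : ℕ) : (powSubgroup G n).Normal := by
  have h : powSubgroup G n = Subgroup.normalClosure (Set.range fun x : G => x ^ n) := by
    refine le_antisymm Subgroup.closure_le_normalClosure ?_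
    refine (Subgroup.closure_le _).2 ?_
    intro y hy
    obtain ⟨a, ⟨x, rfl⟩, hx⟩ := Group.mem_conjugatesOfSet_iff.1 hy
    obtain ⟨c, hc⟩ := isConj_iff.1 hx
    refine Subgroup.subset_closure ⟨c * x * c⁻¹, ?_⟩
    simpa only [conj_pow] using hc
  rw [h]
  infer_instance

/-- The group `F / γ_3(F) F ^ p`, where `F` is the free group on `r` generators. -/
abbrev FreeClassTwoQuot (p r : ℕ) : Type :=
  FreeGroup (Fin r) ⧸ ((⊤ : Subgroup (FreeGroup (Fin r))).lowerCentralSeries 2 ⊔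
    powSubgroup (FreeGroup (Fin r)) p)

/-!
The bounds on `sizeOfType` come from explicit groups, whose orders, class sizes and character
degrees are computed as follows.

*Degrees from above.* If `ρ` is irreducible and `ρ(A)` is commutative for a subgroup `A`, the
translates of a common eigenvector of `A` under coset representatives span the space, so the degree
is at most `|G : A|` (`Representation.IsIrreducible.finrank_le_index`). When `A` is abelian this
settles the groups `M_i` and their products with extraspecial groups. For a group of class two, let
`A` be maximal among the subgroups containing the center whose image is commutative; the commutator
pairing embeds `G / A` into the characters of `A / Z(G)`, so `|G : A| ^ 2 ≤ |G : Z(G)|`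
(`Representation.IsIrreducible.finrank_le_of_class_two`).

*Degrees from below.* Let `A` be normal with a linear character `χ` that is fixed, under
conjugation, by no element outside `A` (`IsSelfStabilizing`). Some irreducible representation
contains an eigenvector with eigencharacter `χ`. Its translates are eigenvectors for distinct
conjugates of `χ`, hence linearly independent, so the degree is at least `|G : A|`
(`IsSelfStabilizing.exists_irreducible`).

*The groups with an abelian subgroup of the right index.* The data consisting of the class sizes,
the abelian subgroup and the self-stabilizing character pass to direct products (`IsStemMonomial`).
For an abelian noncentral normal subgroup `A` of index `p`, every character of `A` that is nontrivial
on some commutator with an element of `A` is self-stabilizing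
(`exists_isSelfStabilizing_of_prime_index`); this applies to the extraspecial groups of order `p ^ 3`, with the centralizer of a noncentral element, and to `M_i`,
with the image of `ℤ_p[θ]`. There `γ_{n+1}` is the ideal `(θ - 1) ^ n` for `n ≥ 1`
(`MInfty.lowerCentralSeries_eq`), of index `p ^ n` in `ℤ_p[θ]` because `ℤ_p[θ] / (θ - 1) = 𝔽_p`.

*The groups of class two.* The group `BilinExt β` is the set `V × W` with the product
`(v, w) (v', w') = (v + v', w + w' + β v v')`. Its commutators are the values of the alternating
map `β v v' - β v' v`, its classes are translates of ranges of this map, and a maximal isotropic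
subgroup for a character of `W` gives a self-stabilizing character
(`BilinExt.isStemPGroupOfType`). The quotient of `UT3 K` by a central subgroup is such a group for
`β` the product of the field followed by the projection. For odd `p` so is the free group of class
two and exponent `p`, with `β v v' = (v_i v'_j)_{i < j}`: it maps onto this model, and a count of
generators of the subgroup spanned by commutators and of the quotient by it shows that it is not
larger.
-/

open scoped commutatorElement

/-! ### Irreducible representations and subgroups acting by scalars -/

/-- Irreducibility in terms of invariant subspaces. -/
theorem Representation.isIrreducible_iff_forall_invariant {G V : Type*} [Group G] [AddCommGroup V]
    [Module ℂ V] (ρ : Representation ℂ G V) :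
    ρ.IsIrreducible ↔ Nontrivial V ∧
      ∀ W : Submodule ℂ V, (∀ g, ∀ v ∈ W, ρ g v ∈ W) → W = ⊥ ∨ W = ⊤ := by
  constructor
  · intro h
    refine ⟨?_, fun W hW => ?_⟩
    · by_contra hV
      rw [not_nontrivial_iff_subsingleton] at hV
      refine h.toNontrivial.exists_pair_ne.elim fun a ha => ha.elim fun b hb => hb ?_
      exact Subrepresentation.toSubmodule_injective (Subsingleton.elim _ _)
    · rcases h.eq_bot_or_eq_top ⟨W, fun g v hv => hW g v hv⟩ with h' | h'
      · exact Or.inl (congrArg Subrepresentation.toSubmodule h')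
      · exact Or.inr (congrArg Subrepresentation.toSubmodule h')
  · rintro ⟨hV, h⟩
    have hne : (⊥ : Subrepresentation ρ) ≠ ⊤ := fun hbt =>
      bot_ne_top (α := Submodule ℂ V) (congrArg Subrepresentation.toSubmodule hbt)
    refine { exists_pair_ne := ⟨_, _, hne⟩, eq_bot_or_eq_top := fun σ => ?_ }
    rcases h σ.toSubmodule (fun g v hv => σ.apply_mem_toSubmodule g hv) with h' | h'
    · exact Or.inl (Subrepresentation.toSubmodule_injective h')
    · exact Or.inr (Subrepresentation.toSubmodule_injective h')

/-- Irreducibility is invariant under a change of space along a linear equivalence and inflation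
along a surjective homomorphism. -/
theorem Representation.IsIrreducible.of_linearEquiv {G H V W : Type*} [Group G] [Group H]
    [AddCommGroup V] [Module ℂ V] [AddCommGroup W] [Module ℂ W]
    {ρ : Representation ℂ G V} (hρ : ρ.IsIrreducible) (σ : Representation ℂ H W) (e : V ≃ₗ[ℂ] W)
    (f : H →* G) (hf : Function.Surjective f) (h : ∀ g v, σ g (e v) = e (ρ (f g) v)) :
    σ.IsIrreducible := by
  rw [Representation.isIrreducible_iff_forall_invariant] at hρ ⊢
  have := hρ.1
  refine ⟨e.symm.toEquiv.nontrivial, fun U hU => ?_⟩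
  have hinj := Submodule.comap_injective_of_surjective (f := e.toLinearMap) e.surjective
  have hinv : ∀ g, ∀ v ∈ U.comap e.toLinearMap, ρ g v ∈ U.comap e.toLinearMap := by
    intro g v hv
    obtain ⟨x, rfl⟩ := hf g
    have := hU x _ hv
    simpa [h] using this
  rcases hρ.2 (U.comap e.toLinearMap) hinv with h' | h'
  · left
    apply hinj
    rw [h', Submodule.comap_bot, LinearEquiv.ker]
  · right
    apply hinj
    rw [h', Submodule.comap_top]

/-- A pairwise commuting set of endomorphisms of a nonzero finite-dimensional complex space has a
common eigenvector: on a minimal nonzero invariant subspace every member acts as a scalar. -/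
theorem Module.End.exists_common_eigenvector {V : Type*} [AddCommGroup V] [Module ℂ V]
    [FiniteDimensional ℂ V] [Nontrivial V] (S : Set (Module.End ℂ V))
    (hS : ∀ f ∈ S, ∀ g ∈ S, Commute f g) :
    ∃ v : V, v ≠ 0 ∧ ∀ f ∈ S, ∃ c : ℂ, f v = c • v := by
  obtain ⟨W, ⟨hW0, hW⟩, hmin⟩ := wellFounded_lt.has_min
    {W : Submodule ℂ V | W ≠ ⊥ ∧ ∀ f ∈ S, ∀ v ∈ W, f v ∈ W}
    ⟨⊤, top_ne_bot, fun _ _ _ _ => trivial⟩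
  obtain ⟨v, hv, hv0⟩ := Submodule.exists_mem_ne_zero_of_ne_bot hW0
  refine ⟨v, hv0, fun f hf => ?_⟩
  have : Nontrivial W := (Submodule.nontrivial_iff_ne_bot).2 hW0
  obtain ⟨c, hc⟩ := Module.End.exists_eigenvalue (f.restrict (hW f hf))
  obtain ⟨w, hw⟩ := hc.exists_hasEigenvector
  have hfw : f w = c • (w : V) := congrArg Subtype.val hw.apply_eq_smul
  have hle : W ≤ Module.End.eigenspace f c := by
    have hnot := hmin (W ⊓ Module.End.eigenspace f c) ⟨?_, fun g hg u hu => ⟨hW g hg u hu.1, ?_⟩⟩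
    · by_contra hle
      exact hnot (inf_lt_left.2 hle)
    · intro h0
      have : (w : V) ∈ W ⊓ Module.End.eigenspace f c :=
        ⟨w.2, Module.End.mem_eigenspace_iff.2 hfw⟩
      rw [h0, Submodule.mem_bot] at this
      exact hw.2 (Subtype.ext this)
    · have h1 := hu.2
      rw [SetLike.mem_coe, Module.End.mem_eigenspace_iff] at h1 ⊢
      have h2 := LinearMap.congr_fun (hS f hf g hg) u
      rw [Module.End.mul_apply, Module.End.mul_apply, h1, map_smul] at h2
      exact h2
  exact ⟨c, Module.End.mem_eigenspace_iff.1 (hle hv)⟩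

/-- The translates of a common eigenvector of `A` under coset representatives span the space, so
the degree of an irreducible representation is at most the index of any subgroup whose image is
commutative. -/
theorem Representation.IsIrreducible.finrank_le_index {G V : Type*} [Group G] [Finite G]
    [AddCommGroup V] [Module ℂ V] [FiniteDimensional ℂ V] {ρ : Representation ℂ G V}
    (hρ : ρ.IsIrreducible) (A : Subgroup G) (hA : ∀ a ∈ A, ∀ b ∈ A, Commute (ρ a) (ρ b)) :
    Module.finrank ℂ V ≤ A.index := by
  rw [Representation.isIrreducible_iff_forall_invariant] at hρ
  obtain ⟨hV, hρ⟩ := hρ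
  obtain ⟨v, hv0, hv⟩ := Module.End.exists_common_eigenvector (ρ '' (A : Set G)) (by
    rintro _ ⟨a, ha, rfl⟩ _ ⟨b, hb, rfl⟩
    exact hA a ha b hb)
  let s : G ⧸ A → V := fun q => ρ q.out v
  have hmem : ∀ g, ρ g v ∈ Submodule.span ℂ (Set.range s) := by
    intro g
    have ha : ((g : G ⧸ A).out)⁻¹ * g ∈ A := by
      rw [← QuotientGroup.eq, QuotientGroup.out_eq']
    obtain ⟨c, hc⟩ := hv _ ⟨_, ha, rfl⟩
    have : ρ g v = c • s (g : G ⧸ A) := by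
      conv_lhs => rw [← mul_inv_cancel_left ((g : G ⧸ A).out) g, map_mul, Module.End.mul_apply, hc]
      rw [map_smul]
    rw [this]
    exact Submodule.smul_mem _ _ (Submodule.subset_span ⟨_, rfl⟩)
  have htop : Submodule.span ℂ (Set.range s) = ⊤ := by
    refine (hρ _ fun g u hu => ?_).resolve_left fun h0 => ?_
    · induction hu using Submodule.span_induction with
      | mem x hx =>
        obtain ⟨q, rfl⟩ := hx
        have := hmem (g * q.out)
        rwa [map_mul] at this
      | zero => rw [map_zero]; exact Submodule.zero_mem _
      | add x y _ _ hx hy => rw [map_add]; exact Submodule.add_mem _ hx hy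
      | smul c x _ hx => rw [map_smul]; exact Submodule.smul_mem _ _ hx
    · have := hmem 1
      rw [h0, Submodule.mem_bot, map_one] at this
      exact hv0 this
  have := Fintype.ofFinite (G ⧸ A)
  have h := finrank_range_le_card (R := ℂ) s
  rw [Set.finrank, htop, finrank_top] at h
  rwa [Subgroup.index, Nat.card_eq_fintype_card]

/-- Simultaneous eigenvectors with pairwise distinct systems of eigenvalues are linearly
independent. -/
theorem linearIndependent_of_injective_eigenvalues {ι κ V : Type*} [AddCommGroup V] [Module ℂ V]
    (f : ι → Module.End ℂ V) (v : κ → V) (hv : ∀ k, v k ≠ 0) (c : κ → ι → ℂ)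
    (hc : Function.Injective c) (h : ∀ i k, f i (v k) = c k i • v k) :
    LinearIndependent ℂ v := by
  classical
  rw [linearIndependent_iff']
  intro s
  induction s using Finset.induction_on with
  | empty => simp
  | insert k₀ s hk₀ ih =>
    intro x hx
    have hs : ∀ k ∈ s, x k = 0 := by
      intro k hk
      obtain ⟨i, hi⟩ := Function.ne_iff.1 (hc.ne (ne_of_mem_of_not_mem hk hk₀))
      have h1 := congrArg (fun u => f i u - c k₀ i • u) hx
      simp only [map_sum, map_smul, h, Finset.smul_sum, map_zero, smul_zero, sub_zero] at h1
      rw [← Finset.sum_sub_distrib, Finset.sum_insert hk₀] at h1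
      have h2 : ∀ j, x j • c j i • v j - c k₀ i • x j • v j
          = (x j * (c j i - c k₀ i)) • v j := fun j => by
        rw [smul_smul, smul_smul, ← sub_smul]
        ring_nf
      simp only [h2, sub_self, mul_zero, zero_smul, zero_add] at h1
      exact (mul_eq_zero.1 (ih _ h1 k hk)).resolve_right (sub_ne_zero.2 hi)
    intro k hk
    rcases Finset.mem_insert.1 hk with rfl | hk
    · rw [Finset.sum_insert hk₀, Finset.sum_eq_zero (fun j hj => by rw [hs j hj, zero_smul]),
        add_zero] at hx
      exact (smul_eq_zero.1 hx).resolve_right (hv k)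
    · exact hs k hk

/-! ### Linear characters that are their own stabilizer -/

/-- `χ` restricts to a linear character of the normal subgroup `A` whose stabilizer in `G`, under
conjugation, is no larger than `A`. Only the values of `χ` on `A` matter; a function on the whole of
`G` is used so that products are easy to form. -/
structure IsSelfStabilizing {G : Type*} [Group G] (A : Subgroup G) (χ : G → ℂ) : Prop where
  normal : A.Normal
  map_one : χ 1 = 1
  map_mul : ∀ a ∈ A, ∀ b ∈ A, χ (a * b) = χ a * χ b
  stabilizer_le : ∀ g, (∀ a ∈ A, χ (g⁻¹ * a * g) = χ a) → g ∈ A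

/-- The translates of an eigenvector of `A` with eigencharacter `χ` have the conjugates of `χ` as
eigencharacters; these are pairwise distinct. -/
theorem IsSelfStabilizing.index_le_finrank {G V : Type*} [Group G] [Finite G] [AddCommGroup V]
    [Module ℂ V] [FiniteDimensional ℂ V] {A : Subgroup G} {χ : G → ℂ} (h : IsSelfStabilizing A χ)
    (ρ : Representation ℂ G V) {v : V} (hv0 : v ≠ 0) (hv : ∀ a ∈ A, ρ a v = χ a • v) :
    A.index ≤ Module.finrank ℂ V := by
  have hli : LinearIndependent ℂ (fun q : G ⧸ A => ρ q.out v) := by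
    refine linearIndependent_of_injective_eigenvalues (fun a : A => ρ a) _ (fun q h0 => hv0 ?_)
      (fun q a => χ (q.out⁻¹ * a * q.out)) ?_ ?_
    · have := congrArg (ρ q.out⁻¹) h0
      rwa [← Module.End.mul_apply, ← _root_.map_mul, inv_mul_cancel, _root_.map_one, map_zero] at this
    · intro q r hqr
      have hmem : q.out⁻¹ * r.out ∈ A := h.stabilizer_le _ fun a ha => by
        have := congrFun hqr ⟨q.out * a * q.out⁻¹, h.normal.conj_mem a ha _⟩
        simp only at this
        rw [show q.out⁻¹ * (q.out * a * q.out⁻¹) * q.out = a by group] at this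
        rw [this]
        congr 1
        group
      rw [← QuotientGroup.eq, QuotientGroup.out_eq', QuotientGroup.out_eq'] at hmem
      exact hmem
    · intro a q
      have ha : q.out⁻¹ * a * q.out ∈ A := by
        simpa using h.normal.conj_mem a a.2 q.out⁻¹
      have := congrArg (ρ q.out) (hv _ ha)
      rw [map_smul] at this
      rw [← this, ← Module.End.mul_apply, ← Module.End.mul_apply, ← _root_.map_mul,
        ← _root_.map_mul]
      congr 2
      group
  have := Fintype.ofFinite (G ⧸ A)
  rw [Subgroup.index, Nat.card_eq_fintype_card]
  exact hli.fintype_card_le_finrank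

/-- If some finite-dimensional representation contains an eigenvector of `A` with eigencharacter
`χ`, then so does some irreducible one: pass to an invariant subspace containing it, or to the
quotient by one not containing it. -/
theorem Representation.exists_irreducible_eigenvector {G V : Type*} [Group G] [AddCommGroup V]
    [Module ℂ V] [FiniteDimensional ℂ V] (ρ : Representation ℂ G V) (A : Subgroup G) (χ : G → ℂ)
    {v : V} (hv0 : v ≠ 0) (hv : ∀ a ∈ A, ρ a v = χ a • v) :
    ∃ (n : ℕ) (σ : Representation ℂ G (Fin n → ℂ)), σ.IsIrreducible ∧
      ∃ w, w ≠ 0 ∧ ∀ a ∈ A, σ a w = χ a • w := by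
  induction hn : Module.finrank ℂ V using Nat.strong_induction_on generalizing V with
  | _ n ih =>
    by_cases hρ : ρ.IsIrreducible
    · subst hn
      let e := LinearEquiv.ofFinrankEq V (Fin (Module.finrank ℂ V) → ℂ)
        (Module.finrank_fin_fun ℂ).symm
      let σ : Representation ℂ G (Fin (Module.finrank ℂ V) → ℂ) :=
        { toFun := fun g => e.conj (ρ g)
          map_one' := by ext; simp [LinearEquiv.conj_apply]
          map_mul' := fun g h => by rw [map_mul]; exact LinearEquiv.conj_comp e _ _ }
      have hσ : ∀ g u, σ g (e u) = e (ρ g u) := fun g u => by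
        simp [σ, LinearEquiv.conj_apply]
      refine ⟨_, σ, hρ.of_linearEquiv σ e (MonoidHom.id G) Function.surjective_id hσ, e v,
        by simpa using hv0, fun a ha => ?_⟩
      rw [hσ, hv a ha, map_smul]
    · rw [Representation.isIrreducible_iff_forall_invariant] at hρ
      push Not at hρ
      obtain ⟨W, hW, hWbot, hWtop⟩ := hρ ⟨v, 0, hv0⟩
      by_cases hvW : v ∈ W
      · let τ : Representation ℂ G W :=
          Subrepresentation.toRepresentation ⟨W, fun g v hv => hW g v hv⟩
        refine ih _ ?_ τ (v := ⟨v, hvW⟩) (by simpa using hv0)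
          (fun a ha => Subtype.ext (hv a ha)) rfl
        rw [← hn]
        exact Submodule.finrank_lt hWtop
      · let τ := ρ.quotient W (fun g u hu => hW g u hu)
        refine ih _ ?_ τ (v := W.mkQ v) (by simpa using hvW)
          (fun a ha => by
            rw [← map_smul, ← hv a ha]
            rfl) rfl
        rw [← hn]
        have := Submodule.finrank_quotient_add_finrank W
        have hpos : 0 < Module.finrank ℂ W :=
          Submodule.one_le_finrank_iff.2 hWbot
        omega

/-- The eigenvector is found in the space of functions on `G`, on which `G` acts by right
translations: it is `χ` extended by zero outside `A`. -/
theorem IsSelfStabilizing.exists_irreducible {G : Type*} [Group G] [Finite G] {A : Subgroup G}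
    {χ : G → ℂ} (h : IsSelfStabilizing A χ) :
    ∃ (n : ℕ) (σ : Representation ℂ G (Fin n → ℂ)), σ.IsIrreducible ∧ A.index ≤ n := by
  classical
  let ρ : Representation ℂ G (G → ℂ) :=
    { toFun := fun g => LinearMap.funLeft ℂ ℂ (fun x => x * g)
      map_one' := by ext; simp [LinearMap.funLeft_apply]
      map_mul' := fun a b => by
        ext f x
        simp [LinearMap.funLeft_apply, Module.End.mul_apply, mul_assoc] }
  have := Fintype.ofFinite G
  obtain ⟨n, σ, hσ, w, hw0, hw⟩ := ρ.exists_irreducible_eigenvector A χ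
    (v := fun x => if x ∈ A then χ x else 0) (fun h0 => by
      have := congrFun h0 1
      simp [A.one_mem, h.map_one] at this) (fun a ha => by
      ext x
      change (if x * a ∈ A then χ (x * a) else 0) = χ a * (if x ∈ A then χ x else 0)
      by_cases hx : x ∈ A
      · rw [if_pos hx, if_pos (A.mul_mem hx ha), h.map_mul x hx a ha, mul_comm]
      · rw [if_neg hx, if_neg (fun h' => hx ((A.mul_mem_cancel_right ha).1 h')), mul_zero])
  refine ⟨n, σ, hσ, ?_⟩
  have := h.index_le_finrank σ hw0 hw
  rwa [Module.finrank_fin_fun] at this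

theorem isRepExponent_of_bounds {p d : ℕ} {G : Type*} [Group G]
    (hle : ∀ (n : ℕ) (ρ : Representation ℂ G (Fin n → ℂ)), ρ.IsIrreducible → n ≤ p ^ d)
    (hex : ∃ (n : ℕ) (ρ : Representation ℂ G (Fin n → ℂ)), ρ.IsIrreducible ∧ p ^ d ≤ n) :
    IsRepExponent p G d := by
  constructor
  · obtain ⟨n, ρ, hρ, hn⟩ := hex
    refine ⟨ρ.character, ⟨n, ρ, hρ, rfl⟩, ?_⟩
    rw [Representation.char_one, Module.finrank_fin_fun, le_antisymm (hle n ρ hρ) hn]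
  · rintro m ⟨χ, ⟨n, ρ, hρ, rfl⟩, hm⟩
    rw [Representation.char_one, Module.finrank_fin_fun, Nat.cast_inj] at hm
    exact hm ▸ hle n ρ hρ

/-! ### Degrees in class two -/

/-- Schur's lemma for central elements. -/
theorem Representation.IsIrreducible.exists_scalar_of_mem_center {G V : Type*} [Group G]
    [AddCommGroup V] [Module ℂ V] [FiniteDimensional ℂ V] {ρ : Representation ℂ G V}
    (hρ : ρ.IsIrreducible) {z : G} (hz : z ∈ Subgroup.center G) : ∃ c : ℂ, ρ z = c • 1 := by
  rw [Representation.isIrreducible_iff_forall_invariant] at hρ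
  obtain ⟨hV, hρ⟩ := hρ
  obtain ⟨c, hc⟩ := Module.End.exists_eigenvalue (ρ z)
  refine ⟨c, LinearMap.ext fun v => ?_⟩
  have htop := (hρ (Module.End.eigenspace (ρ z) c) fun g u hu => ?_).resolve_left hc
  · exact Module.End.mem_eigenspace_iff.1 (htop ▸ Submodule.mem_top : v ∈ _)
  · rw [Module.End.mem_eigenspace_iff] at hu ⊢
    rw [← Module.End.mul_apply, ← map_mul, ← Subgroup.mem_center_iff.1 hz g, map_mul,
      Module.End.mul_apply, hu, map_smul]

/-- A finite group has at most as many linear characters as elements. -/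
theorem card_le_of_injective_monoidHom {M ι : Type*} [Monoid M] [Finite M] [Finite ι]
    (f : ι → M →* ℂ) (hf : Function.Injective f) : Nat.card ι ≤ Nat.card M := by
  have := Fintype.ofFinite M
  have := Fintype.ofFinite ι
  have h := ((linearIndependent_monoidHom M ℂ).comp f hf).fintype_card_le_finrank
  rwa [Module.finrank_fintype_fun_eq_card, ← Nat.card_eq_fintype_card,
    ← Nat.card_eq_fintype_card] at h

/-- Let `A` be maximal among the subgroups containing the center whose image is commutative. The
commutator pairing, with values in the scalars, embeds `G / A` into the characters of `A / Z(G)`,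
whence `|G : A| ^ 2 ≤ |G : Z(G)|`; and the degree is at most `|G : A|`. -/
theorem Representation.IsIrreducible.finrank_le_of_class_two {p m : ℕ} [Fact p.Prime]
    {G V : Type*} [Group G] [Finite G] [AddCommGroup V] [Module ℂ V] [FiniteDimensional ℂ V]
    {ρ : Representation ℂ G V} (hρ : ρ.IsIrreducible) (hp : IsPGroup p G)
    (hG : commutator G ≤ Subgroup.center G) (hm : (Subgroup.center G).index = p ^ m) :
    Module.finrank ℂ V ≤ p ^ (m / 2) := by
  have hcomm : ∀ g h : G, ⁅g, h⁆ ∈ Subgroup.center G := fun g h =>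
    hG (Subgroup.commutator_mem_commutator (Subgroup.mem_top g) (Subgroup.mem_top h))
  have hV : Nontrivial V := ((Representation.isIrreducible_iff_forall_invariant ρ).1 hρ).1
  obtain ⟨A, ⟨hZA, hA⟩, hmax⟩ := wellFounded_gt.has_min
    {A : Subgroup G | Subgroup.center G ≤ A ∧ ∀ a ∈ A, ∀ b ∈ A, Commute (ρ a) (ρ b)}
    ⟨Subgroup.center G, le_rfl, fun a ha b _ => by
      rw [commute_iff_eq, ← map_mul, ← map_mul, Subgroup.mem_center_iff.1 ha b]⟩
  -- maximality of `A`: it contains every element whose image commutes with that of `A`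
  have hAmax : ∀ g, (∀ a ∈ A, Commute (ρ g) (ρ a)) → g ∈ A := by
    intro g hg
    have hle : A ≤ Subgroup.closure (insert g (A : Set G)) := fun a ha =>
      Subgroup.subset_closure (Set.mem_insert_of_mem _ ha)
    have hmem : g ∈ Subgroup.closure (insert g (A : Set G)) :=
      Subgroup.subset_closure (Set.mem_insert _ _)
    by_contra hgA
    refine hmax (Subgroup.closure (insert g (A : Set G))) ⟨hZA.trans hle, fun a ha b hb => ?_⟩
      (lt_of_le_of_ne hle fun h => hgA (h ▸ hmem))
    have hinv : ∀ x y : G, Commute (ρ x) (ρ y) → Commute (ρ x⁻¹) (ρ y) := by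
      intro x y hxy
      have h1 : ρ x⁻¹ * ρ x = 1 := by rw [← map_mul, inv_mul_cancel, map_one]
      have h2 : ρ x * ρ x⁻¹ = 1 := by rw [← map_mul, mul_inv_cancel, map_one]
      calc ρ x⁻¹ * ρ y = ρ x⁻¹ * (ρ y * (ρ x * ρ x⁻¹)) := by rw [h2, mul_one]
        _ = ρ x⁻¹ * (ρ x * ρ y) * ρ x⁻¹ := by rw [hxy.eq]; simp only [mul_assoc]
        _ = ρ y * ρ x⁻¹ := by rw [← mul_assoc (ρ x⁻¹), h1, one_mul]
    induction ha, hb using Subgroup.closure_induction₂ with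
    | mem x y hx hy =>
      rcases hx with rfl | hx <;> rcases hy with rfl | hy
      · exact Commute.refl _
      · exact hg y hy
      · exact (hg x hx).symm
      · exact hA x hx y hy
    | one_left x _ => rw [map_one]; exact Commute.one_left _
    | one_right x _ => rw [map_one]; exact Commute.one_right _
    | mul_left x y z _ _ _ h1 h2 => rw [map_mul]; exact h1.mul_left h2
    | mul_right x y z _ _ _ h1 h2 => rw [map_mul]; exact h1.mul_right h2
    | inv_left x y _ _ h => exact hinv _ _ h
    | inv_right x y _ _ h => exact (hinv _ _ h.symm).symm
  choose s hs using fun z : Subgroup.center G => hρ.exists_scalar_of_mem_center z.2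
  have hs_unique : ∀ (z : Subgroup.center G) (c : ℂ), ρ z = c • 1 → s z = c := by
    intro z c hc
    rw [hs] at hc
    obtain ⟨v, hv⟩ := exists_ne (0 : V)
    exact smul_left_injective ℂ hv (LinearMap.congr_fun hc v)
  let c : G → A →* ℂ := fun g =>
    { toFun := fun a => s ⟨⁅g, a⁆, hcomm g a⟩
      map_one' := hs_unique _ _ (by simp)
      map_mul' := fun a b => hs_unique _ _ (by
        have h1 : ⁅g, (a * b : G)⁆ = ⁅g, (a : G)⁆ * ⁅g, (b : G)⁆ := by
          have := Subgroup.mem_center_iff.1 (hcomm g b) a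
          calc ⁅g, (a * b : G)⁆ = ⁅g, (a : G)⁆ * (a * ⁅g, (b : G)⁆) * (a : G)⁻¹ := by
                simp only [commutatorElement_def]; group
            _ = ⁅g, (a : G)⁆ * ⁅g, (b : G)⁆ := by rw [this]; group
        have h2 := hs ⟨⁅g, (a : G)⁆, hcomm g a⟩
        have h3 := hs ⟨⁅g, (b : G)⁆, hcomm g b⟩
        simp only at h2 h3
        simp only [Subgroup.coe_mul, h1, map_mul, h2, h3]
        rw [smul_mul_smul_comm, one_mul]) }
  have hc : ∀ g (a : A), ρ ⁅g, (a : G)⁆ = c g a • 1 := fun g a => hs ⟨⁅g, (a : G)⁆, hcomm g a⟩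
  have hcker : ∀ g, (Subgroup.center G).subgroupOf A ≤ (c g).ker := by
    intro g a ha
    refine MonoidHom.mem_ker.2 (hs_unique _ _ ?_)
    have : ⁅g, (a : G)⁆ = 1 :=
      commutatorElement_eq_one_iff_mul_comm.2 (Subgroup.mem_center_iff.1 ha g)
    simp only [this, map_one, one_smul]
  let f : G ⧸ A → (A ⧸ (Subgroup.center G).subgroupOf A) →* ℂ := fun q =>
    QuotientGroup.lift _ (c q.out) (hcker q.out)
  have hf : Function.Injective f := by
    intro q r hqr
    have hcc : ∀ a : A, c q.out a = c r.out a := fun a =>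
      DFunLike.congr_fun hqr (QuotientGroup.mk a)
    have hmem : q.out⁻¹ * r.out ∈ A := hAmax _ fun a ha => by
      -- equal commutators with `a` mean equal conjugates of `a`
      have h1 : ρ ⁅q.out, a⁆ = ρ ⁅r.out, a⁆ := by
        rw [hc q.out ⟨a, ha⟩, hc r.out ⟨a, ha⟩, hcc]
      have h2 : ρ (q.out * a * q.out⁻¹) = ρ (r.out * a * r.out⁻¹) := by
        have := congrArg (· * ρ a) h1
        simp only [← map_mul, commutatorElement_def, inv_mul_cancel_right] at this
        exact this
      have h3 := congrArg (fun T => ρ q.out⁻¹ * T * ρ r.out) h2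
      simp only [← map_mul] at h3
      rw [commute_iff_eq, ← map_mul, ← map_mul]
      calc ρ (q.out⁻¹ * r.out * a) = ρ (q.out⁻¹ * (r.out * a * r.out⁻¹) * r.out) := by
            congr 1; group
        _ = _ := h3.symm
        _ = _ := by congr 1; group
    rw [← QuotientGroup.eq, QuotientGroup.out_eq', QuotientGroup.out_eq'] at hmem
    exact hmem
  have h1 : A.index ≤ (Subgroup.center G).relIndex A := card_le_of_injective_monoidHom f hf
  have h2 := Subgroup.relIndex_mul_index hZA
  obtain ⟨k, hk⟩ := hp.index A
  have h3 : p ^ (2 * k) ≤ p ^ m := by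
    rw [← hm, ← h2, two_mul, pow_add, ← hk]
    exact Nat.mul_le_mul_right _ h1
  have h4 := (Nat.pow_le_pow_iff_right (Fact.out : p.Prime).one_lt).1 h3
  refine (hρ.finrank_le_index A hA).trans ?_
  rw [hk]
  exact Nat.pow_le_pow_right (Fact.out : p.Prime).pos (by omega)

/-! ### Conjugacy classes, and direct products -/

theorem isBreadth_of_bounds {p b : ℕ} [Fact p.Prime] {G : Type*} [Group G]
    (hle : ∀ g : G, Nat.card (conjugatesOf g) ≤ p ^ b)
    (hex : ∃ g : G, Nat.card (conjugatesOf g) = p ^ b) : IsBreadth p G b :=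
  ⟨hex, by
    rintro n ⟨g, hg⟩
    exact (Nat.pow_le_pow_iff_right (Fact.out : p.Prime).one_lt).1 (hg ▸ hle g)⟩

theorem conjugatesOf_eq_range {G : Type*} [Group G] (g : G) :
    conjugatesOf g = Set.range fun x : G => x * g * x⁻¹ := by
  ext y
  exact isConj_iff

theorem conjugatesOf_prod {G H : Type*} [Group G] [Group H] (x : G × H) :
    conjugatesOf x = conjugatesOf x.1 ×ˢ conjugatesOf x.2 := by
  ext y
  simp only [conjugatesOf_eq_range, Set.mem_range, Set.mem_prod, Prod.ext_iff, Prod.exists]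
  constructor
  · rintro ⟨a, b, h1, h2⟩
    exact ⟨⟨a, h1⟩, ⟨b, h2⟩⟩
  · rintro ⟨⟨a, h1⟩, ⟨b, h2⟩⟩
    exact ⟨a, b, h1, h2⟩

theorem conjugatesOf_pi {ι : Type*} {G : ι → Type*} [∀ i, Group (G i)] (x : ∀ i, G i) :
    conjugatesOf x = Set.univ.pi fun i => conjugatesOf (x i) := by
  ext y
  simp only [conjugatesOf_eq_range, Set.mem_range, Set.mem_univ_pi, funext_iff]
  exact Classical.skolem (p := fun i (a : G i) => a * x i * a⁻¹ = y i).symm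

theorem card_conjugatesOf_prod {G H : Type*} [Group G] [Group H] (x : G × H) :
    Nat.card (conjugatesOf x) = Nat.card (conjugatesOf x.1) * Nat.card (conjugatesOf x.2) := by
  rw [conjugatesOf_prod, Nat.card_congr (Equiv.Set.prod _ _), Nat.card_prod]

theorem card_conjugatesOf_pi {ι : Type*} [Fintype ι] {G : ι → Type*} [∀ i, Group (G i)]
    (x : ∀ i, G i) :
    Nat.card (conjugatesOf x) = ∏ i, Nat.card (conjugatesOf (x i)) := by
  rw [conjugatesOf_pi, Nat.card_congr (Equiv.Set.univPi _), Nat.card_pi]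

theorem IsSelfStabilizing.prod {G H : Type*} [Group G] [Group H] {A : Subgroup G} {B : Subgroup H}
    {χ : G → ℂ} {ψ : H → ℂ} (hA : IsSelfStabilizing A χ) (hB : IsSelfStabilizing B ψ) :
    IsSelfStabilizing (A.prod B) (fun x => χ x.1 * ψ x.2) where
  normal := by
    have := hA.normal
    have := hB.normal
    exact Subgroup.prod_normal A B
  map_one := by simp [hA.map_one, hB.map_one]
  map_mul := by
    rintro ⟨a, b⟩ ⟨ha, hb⟩ ⟨a', b'⟩ ⟨ha', hb'⟩
    change χ (a * a') * ψ (b * b') = _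
    rw [hA.map_mul a ha a' ha', hB.map_mul b hb b' hb']
    ring
  stabilizer_le := by
    rintro ⟨g, h⟩ hgh
    refine ⟨hA.stabilizer_le g fun a ha => ?_, hB.stabilizer_le h fun b hb => ?_⟩
    · simpa [hB.map_one] using hgh (a, 1) ⟨ha, B.one_mem⟩
    · simpa [hA.map_one] using hgh (1, b) ⟨A.one_mem, hb⟩

theorem IsSelfStabilizing.pi {ι : Type*} [Fintype ι] {G : ι → Type*} [∀ i, Group (G i)]
    {A : ∀ i, Subgroup (G i)} {χ : ∀ i, G i → ℂ} (h : ∀ i, IsSelfStabilizing (A i) (χ i)) :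
    IsSelfStabilizing (Subgroup.pi Set.univ A) (fun x => ∏ i, χ i (x i)) where
  normal := ⟨fun x hx g i _ => (h i).normal.conj_mem _ (hx i trivial) _⟩
  map_one := Finset.prod_eq_one fun i _ => (h i).map_one
  map_mul := fun a ha b hb => by
    rw [← Finset.prod_mul_distrib]
    exact Finset.prod_congr rfl fun i _ =>
      (h i).map_mul _ (ha i trivial) _ (hb i trivial)
  stabilizer_le := by
    classical
    intro g hg i _
    refine (h i).stabilizer_le _ fun a ha => ?_
    have hmem : Pi.mulSingle i a ∈ Subgroup.pi Set.univ A := fun j _ => by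
      by_cases hj : j = i
      · subst hj
        simpa using ha
      · rw [Pi.mulSingle_eq_of_ne hj]
        exact (A j).one_mem
    have := hg _ hmem
    rwa [Finset.prod_eq_single i, Finset.prod_eq_single i, Pi.mul_apply, Pi.mul_apply,
      Pi.inv_apply, Pi.mulSingle_eq_same] at this
    · intro j _ hj
      rw [Pi.mulSingle_eq_of_ne hj, (h j).map_one]
    · simp
    · intro j _ hj
      simp [Pi.mulSingle_eq_of_ne hj, (h j).map_one]
    · simp

theorem Subgroup.index_univ_pi {ι : Type*} [Fintype ι] {G : ι → Type*} [∀ i, Group (G i)]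
    [∀ i, Finite (G i)] (A : ∀ i, Subgroup (G i)) :
    (Subgroup.pi Set.univ A).index = ∏ i, (A i).index := by
  have h1 : Nat.card (Subgroup.pi Set.univ A) = ∏ i, Nat.card (A i) := by
    rw [← Nat.card_pi]
    exact Nat.card_congr (Equiv.Set.univPi fun i => (A i : Set (G i)))
  have h2 := (Subgroup.pi Set.univ A).card_mul_index
  rw [h1, Nat.card_pi, ← Finset.prod_congr rfl fun i _ => (A i).card_mul_index,
    Finset.prod_mul_distrib] at h2
  exact Nat.eq_of_mul_eq_mul_left (Finset.prod_pos fun i _ => Nat.card_pos) h2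

/-- A stem `p`-group with largest class size `p ^ b` and an abelian normal subgroup of index `p ^ d`
carrying a linear character that is its own stabilizer. Such groups are closed under direct
products, and have breadth-degree type `(b, d)`. -/
structure IsStemMonomial (p : ℕ) (G : Type*) [Group G] (b d : ℕ) : Prop where
  finite : Finite G
  isPGroup : IsPGroup p G
  isStem : IsStem G
  card_conjugatesOf_le : ∀ g : G, Nat.card (conjugatesOf g) ≤ p ^ b
  exists_card_conjugatesOf : ∃ g : G, Nat.card (conjugatesOf g) = p ^ b
  exists_character : ∃ (A : Subgroup G) (χ : G → ℂ), IsSelfStabilizing A χ ∧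
    (∀ a ∈ A, ∀ b ∈ A, Commute a b) ∧ A.index = p ^ d

theorem IsStemMonomial.isStemPGroupOfType {p b d : ℕ} [Fact p.Prime] {G : Type*} [Group G]
    (h : IsStemMonomial p G b d) : IsStemPGroupOfType p G b d := by
  obtain ⟨A, χ, hχ, hA, hd⟩ := h.exists_character
  have := h.finite
  refine ⟨h.finite, h.isPGroup, h.isStem,
    isBreadth_of_bounds h.card_conjugatesOf_le h.exists_card_conjugatesOf,
    isRepExponent_of_bounds (fun n ρ hρ => ?_) ?_⟩
  · have := hρ.finrank_le_index A fun a ha b hb => (hA a ha b hb).map ρ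
    rwa [hd, Module.finrank_fin_fun] at this
  · rw [← hd]
    exact hχ.exists_irreducible

theorem IsStemMonomial.prod {p b d b' d' : ℕ} [Fact p.Prime] {G H : Type*} [Group G] [Group H]
    (hG : IsStemMonomial p G b d) (hH : IsStemMonomial p H b' d') :
    IsStemMonomial p (G × H) (b + b') (d + d') := by
  have := hG.finite
  have := hH.finite
  obtain ⟨A, χ, hχ, hA, hAd⟩ := hG.exists_character
  obtain ⟨B, ψ, hψ, hB, hBd⟩ := hH.exists_character
  refine ⟨inferInstance, ?_, ?_, fun x => ?_, ?_, ?_⟩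
  · obtain ⟨n, hn⟩ := IsPGroup.iff_card.1 hG.isPGroup
    obtain ⟨m, hm⟩ := IsPGroup.iff_card.1 hH.isPGroup
    exact IsPGroup.iff_card.2 ⟨n + m, by rw [Nat.card_prod, hn, hm, pow_add]⟩
  · intro x hx
    rw [commutator_def, ← Subgroup.top_prod_top, Subgroup.commutator_prod_prod]
    refine ⟨hG.isStem (Subgroup.mem_center_iff.2 fun g => ?_),
      hH.isStem (Subgroup.mem_center_iff.2 fun g => ?_)⟩
    · exact congrArg Prod.fst (Subgroup.mem_center_iff.1 hx (g, 1))
    · exact congrArg Prod.snd (Subgroup.mem_center_iff.1 hx (1, g))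
  · rw [card_conjugatesOf_prod, pow_add]
    exact Nat.mul_le_mul (hG.card_conjugatesOf_le _) (hH.card_conjugatesOf_le _)
  · obtain ⟨g, hg⟩ := hG.exists_card_conjugatesOf
    obtain ⟨h, hh⟩ := hH.exists_card_conjugatesOf
    exact ⟨(g, h), by rw [card_conjugatesOf_prod, hg, hh, pow_add]⟩
  · refine ⟨A.prod B, _, hχ.prod hψ, fun x hx y hy => ?_, ?_⟩
    · exact Prod.ext (hA _ hx.1 _ hy.1) (hB _ hx.2 _ hy.2)
    · rw [Subgroup.index_prod, hAd, hBd, pow_add]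

theorem IsStemMonomial.pi {p : ℕ} [Fact p.Prime] {ι : Type*} [Fintype ι] {b d : ι → ℕ}
    {G : ι → Type*} [∀ i, Group (G i)] (h : ∀ i, IsStemMonomial p (G i) (b i) (d i)) :
    IsStemMonomial p (∀ i, G i) (∑ i, b i) (∑ i, d i) := by
  have := fun i => (h i).finite
  choose A χ hχ hA hd using fun i => (h i).exists_character
  refine ⟨inferInstance, ?_, ?_, fun x => ?_, ?_, ?_⟩
  · choose n hn using fun i => IsPGroup.iff_card.1 (h i).isPGroup
    exact IsPGroup.iff_card.2 ⟨∑ i, n i, by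
      rw [Nat.card_pi, ← Finset.prod_pow_eq_pow_sum]
      exact Finset.prod_congr rfl fun i _ => hn i⟩
  · classical
    intro x hx
    rw [commutator_def, ← Subgroup.pi_top Set.univ, Subgroup.commutator_pi_pi_of_finite]
    intro i _
    refine (h i).isStem (Subgroup.mem_center_iff.2 fun g => ?_)
    simpa using congrFun (Subgroup.mem_center_iff.1 hx (Pi.mulSingle i g)) i
  · rw [card_conjugatesOf_pi, ← Finset.prod_pow_eq_pow_sum]
    exact Finset.prod_le_prod' fun i _ => (h i).card_conjugatesOf_le _
  · choose g hg using fun i => (h i).exists_card_conjugatesOf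
    refine ⟨g, ?_⟩
    rw [card_conjugatesOf_pi, ← Finset.prod_pow_eq_pow_sum]
    exact Finset.prod_congr rfl fun i _ => hg i
  · refine ⟨Subgroup.pi Set.univ A, _, IsSelfStabilizing.pi hχ, fun x hx y hy => ?_, ?_⟩
    · exact funext fun i => hA i _ (hx i trivial) _ (hy i trivial)
    · rw [Subgroup.index_univ_pi, ← Finset.prod_pow_eq_pow_sum]
      exact Finset.prod_congr rfl fun i _ => hd i

/-- The characters of a finite abelian subgroup separate its elements. -/
theorem Subgroup.exists_character_ne_one {G : Type*} [Group G] [Finite G] (A : Subgroup G)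
    (hA : ∀ a ∈ A, ∀ b ∈ A, Commute a b) {x : G} (hx : x ∈ A) (hx1 : x ≠ 1) :
    ∃ χ : A →* ℂˣ, χ ⟨x, hx⟩ ≠ 1 := by
  let _ : CommGroup A :=
    { (inferInstance : Group A) with mul_comm := fun a b => Subtype.ext (hA a a.2 b b.2) }
  have hne : NeZero (Monoid.exponent A) := ⟨Monoid.exponent_ne_zero_of_finite⟩
  exact CommGroup.exists_apply_ne_one_of_hasEnoughRootsOfUnity A ℂ
    (a := ⟨x, hx⟩) fun h => hx1 (congrArg Subtype.val h)

theorem Subgroup.isCoatom_of_index_eq_prime {p : ℕ} [Fact p.Prime] {G : Type*} [Group G]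
    {A : Subgroup G} (hA : A.index = p) : IsCoatom A := by
  have hp : p.Prime := Fact.out
  refine ⟨fun h => hp.ne_one (by rw [← hA, h, Subgroup.index_top]), fun H hH => ?_⟩
  have h1 := Subgroup.relIndex_mul_index hH.le
  rw [hA] at h1
  rcases (Nat.dvd_prime hp).1 (Dvd.intro _ h1) with h2 | h2
  · exact absurd (Subgroup.relIndex_eq_one.1 h2) hH.not_ge
  · rw [h2] at h1
    exact Subgroup.index_eq_one.1 (Nat.eq_of_mul_eq_mul_left hp.pos (by rw [h1, mul_one]))

/-- The stabilizer of a character of `A` is either `A` or the whole group, and it is not the whole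
group if the character does not vanish on some commutator with an element of `A`. -/
theorem exists_isSelfStabilizing_of_prime_index {p : ℕ} [Fact p.Prime] {G : Type*} [Group G]
    [Finite G] (A : Subgroup G) [A.Normal] (hA : ∀ a ∈ A, ∀ b ∈ A, Commute a b)
    (hp : A.index = p) (hc : ¬ A ≤ Subgroup.center G) : ∃ χ, IsSelfStabilizing A χ := by
  classical
  obtain ⟨x, hx, hxc⟩ := SetLike.not_le_iff_exists.1 hc
  rw [Subgroup.mem_center_iff] at hxc
  push Not at hxc
  obtain ⟨g, hg⟩ := hxc
  have hgx : g⁻¹ * x * g ∈ A := by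
    simpa using (inferInstance : A.Normal).conj_mem x hx g⁻¹
  obtain ⟨ψ, hψ⟩ := A.exists_character_ne_one hA (A.mul_mem hgx (A.inv_mem hx)) (fun h => hg (by
    rw [mul_inv_eq_one] at h
    calc g * x = g * (g⁻¹ * x * g) := by rw [h]
      _ = x * g := by group))
  let χ : G → ℂ := fun y => if hy : y ∈ A then (ψ ⟨y, hy⟩ : ℂ) else 0
  have hχ : ∀ a (ha : a ∈ A), χ a = ψ ⟨a, ha⟩ := fun a ha => dif_pos ha
  have hmul : ∀ a ∈ A, ∀ b ∈ A, χ (a * b) = χ a * χ b := fun a ha b hb => by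
    rw [hχ a ha, hχ b hb, hχ _ (A.mul_mem ha hb), ← Units.val_mul, ← map_mul]
    rfl
  have hconj : ∀ (h : G), ∀ a ∈ A, h⁻¹ * a * h ∈ A := fun h a ha => by
    simpa using (inferInstance : A.Normal).conj_mem a ha h⁻¹
  -- the stabilizer of the character
  let S : Subgroup G :=
    { carrier := {h | ∀ a ∈ A, χ (h⁻¹ * a * h) = χ a}
      one_mem' := fun a _ => by simp
      mul_mem' := fun {h k} hh hk a ha => by
        rw [← hh a ha, ← hk _ (hconj h a ha)]
        congr 1
        group
      inv_mem' := fun {h} hh a ha => by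
        have := hh (h⁻¹⁻¹ * a * h⁻¹) (hconj _ a ha)
        rw [← this]
        congr 1
        group }
  have hAS : A ≤ S := fun h hh a ha => by
    rw [(hA _ (A.inv_mem hh) _ ha).eq, inv_mul_cancel_right]
  have hSg : g ∉ S := fun h => by
    refine hψ (Units.ext ?_)
    have h1 := h x hx
    have h2 : χ (g⁻¹ * x * g * x⁻¹) = χ (x * x⁻¹) := by
      rw [hmul _ hgx _ (A.inv_mem hx), h1, ← hmul _ hx _ (A.inv_mem hx)]
    rw [hχ _ (A.mul_mem hgx (A.inv_mem hx)), hχ _ (A.mul_mem hx (A.inv_mem hx))] at h2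
    rw [h2]
    have : (⟨x * x⁻¹, A.mul_mem hx (A.inv_mem hx)⟩ : A) = 1 := Subtype.ext (mul_inv_cancel x)
    rw [this, map_one]
  refine ⟨χ, inferInstance, ?_, hmul, fun h hh => ?_⟩
  · rw [hχ 1 A.one_mem]
    have : (⟨1, A.one_mem⟩ : A) = 1 := rfl
    rw [this, map_one, Units.val_one]
  · have hS : S = A := ((Subgroup.isCoatom_of_index_eq_prime hp).le_iff.1 hAS).resolve_left
      fun htop => hSg (htop ▸ Subgroup.mem_top g)
    exact hS ▸ hh

/-! ### Extraspecial groups of order `p ^ 3` -/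

theorem conj_mul_inv_mem_commutator {G : Type*} [Group G] (x g : G) :
    x * g * x⁻¹ * g⁻¹ ∈ commutator G :=
  Subgroup.commutator_mem_commutator (Subgroup.mem_top x) (Subgroup.mem_top g)

/-- A conjugacy class is contained in a coset of the derived subgroup. -/
theorem card_conjugatesOf_le_card_commutator {G : Type*} [Group G] [Finite G] (g : G) :
    Nat.card (conjugatesOf g) ≤ Nat.card (commutator G) := by
  have hmem : ∀ y : conjugatesOf g, (y : G) * g⁻¹ ∈ commutator G := by
    rintro ⟨y, hy⟩
    rw [conjugatesOf_eq_range] at hy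
    obtain ⟨x, rfl⟩ := hy
    exact conj_mul_inv_mem_commutator x g
  refine Nat.card_le_card_of_injective (fun y => ⟨(y : G) * g⁻¹, hmem y⟩) fun y z h => ?_
  exact Subtype.ext (mul_right_cancel (congrArg Subtype.val h))

theorem card_conjugatesOf_eq_index_centralizer {G : Type*} [Group G] (g : G) :
    Nat.card (conjugatesOf g) = (Subgroup.centralizer {g}).index := by
  rw [Subgroup.index]
  symm
  have hiff : ∀ x y : G, x⁻¹ * y ∈ Subgroup.centralizer {g} ↔ x * g * x⁻¹ = y * g * y⁻¹ := by
    intro x y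
    rw [Subgroup.mem_centralizer_singleton_iff]
    constructor
    · intro h
      calc x * g * x⁻¹ = x * (g * (x⁻¹ * y)) * y⁻¹ := by group
        _ = x * ((x⁻¹ * y) * g) * y⁻¹ := by rw [h]
        _ = _ := by group
    · intro h
      calc x⁻¹ * y * g = x⁻¹ * (y * g * y⁻¹) * y := by group
        _ = x⁻¹ * (x * g * x⁻¹) * y := by rw [h]
        _ = _ := by group
  refine Nat.card_congr (Equiv.ofBijective
    (fun q => (⟨q.out * g * q.out⁻¹, by rw [conjugatesOf_eq_range]; exact ⟨_, rfl⟩⟩ :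
      conjugatesOf g)) ⟨fun q r h => ?_, fun y => ?_⟩)
  · have := (hiff _ _).2 (congrArg Subtype.val h)
    rwa [← QuotientGroup.eq, QuotientGroup.out_eq', QuotientGroup.out_eq'] at this
  · obtain ⟨y, hy⟩ := y
    rw [conjugatesOf_eq_range] at hy
    obtain ⟨x, rfl⟩ := hy
    refine ⟨(x : G ⧸ Subgroup.centralizer {g}), Subtype.ext ((hiff _ _).1 ?_)⟩
    rw [← QuotientGroup.eq, QuotientGroup.out_eq']

theorem IsExtraspecial.isStemMonomial {p : ℕ} [Fact p.Prime] {E : Type*} [Group E]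
    (h : IsExtraspecial p E) (hcard : Nat.card E = p ^ 3) : IsStemMonomial p E 1 1 := by
  have hp : p.Prime := Fact.out
  have := h.finite
  have hZtop : Subgroup.center E ≠ ⊤ := fun htop => by
    have h1 := h.card_center
    rw [htop, Subgroup.card_top, hcard] at h1
    exact absurd (Nat.pow_right_injective hp.two_le (h1.trans (pow_one p).symm)) (by decide)
  obtain ⟨g, -, hg⟩ := SetLike.exists_of_lt (lt_top_iff_ne_top.2 hZtop)
  have hgA : g ∈ Subgroup.centralizer {g} := Subgroup.mem_centralizer_singleton_iff.2 rfl
  -- the order of the centralizer of `g` lies strictly between `p` and `p ^ 3`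
  have hA : Nat.card (Subgroup.centralizer {g}) = p ^ 2 := by
    obtain ⟨k, hk3, hk⟩ := (Nat.dvd_prime_pow hp).1
      (hcard ▸ Subgroup.card_subgroup_dvd_card (Subgroup.centralizer {g}))
    have hlt : Subgroup.center E < Subgroup.centralizer {g} :=
      lt_of_le_of_ne (Subgroup.center_le_centralizer _) fun heq => hg (heq ▸ hgA)
    have h1 : 1 < k := by
      by_contra hk1
      refine hlt.ne (Subgroup.eq_of_le_of_card_ge hlt.le ?_)
      rw [hk, h.card_center]
      exact (Nat.pow_le_pow_right hp.pos (not_lt.1 hk1)).trans (pow_one p).le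
    have h2 : k ≠ 3 := by
      rintro rfl
      have htop := Subgroup.eq_top_of_card_eq _ (hk.trans hcard.symm)
      refine hg (Subgroup.mem_center_iff.2 fun x => ?_)
      exact Subgroup.mem_centralizer_singleton_iff.1 (htop ▸ Subgroup.mem_top x)
    rw [hk, show k = 2 by omega]
  have hAp : (Subgroup.centralizer {g}).index = p := by
    have := (Subgroup.centralizer {g}).card_mul_index
    rw [hA, hcard] at this
    exact Nat.eq_of_mul_eq_mul_left (pow_pos hp.pos 2) this
  have hAcomm : ∀ a ∈ Subgroup.centralizer {g}, ∀ b ∈ Subgroup.centralizer {g}, Commute a b := by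
    intro a ha b hb
    have := IsPGroup.isMulCommutative_of_card_eq_prime_sq hA
    exact congrArg Subtype.val (this.is_comm.comm ⟨a, ha⟩ ⟨b, hb⟩)
  have hAnormal : (Subgroup.centralizer {g}).Normal := by
    refine ⟨fun a ha x => ?_⟩
    have hle : commutator E ≤ Subgroup.centralizer {g} :=
      h.commutator_eq.le.trans (Subgroup.center_le_centralizer _)
    simpa using (Subgroup.centralizer {g}).mul_mem (hle (conj_mul_inv_mem_commutator x a)) ha
  obtain ⟨χ, hχ⟩ := exists_isSelfStabilizing_of_prime_index _ hAcomm hAp fun hle => hg (hle hgA)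
  refine ⟨h.finite, h.isPGroup, h.commutator_eq.ge, fun x => ?_, ⟨g, ?_⟩,
    ⟨_, χ, hχ, hAcomm, by rw [hAp, pow_one]⟩⟩
  · rw [pow_one, ← h.card_center, ← h.commutator_eq]
    exact card_conjugatesOf_le_card_commutator x
  · rw [card_conjugatesOf_eq_index_centralizer, hAp, pow_one]

/-! ### The ring `ℤ_p[θ]` -/

/-- The uniformizer `θ - 1` of `ℤ_p[θ]`. -/
noncomputable def thetaSubOne (p : ℕ) [Fact p.Prime] : ZpTheta p := (theta p : ZpTheta p) - 1

theorem theta_isPrimitiveRoot (p : ℕ) [Fact p.Prime] : IsPrimitiveRoot (theta p : ZpTheta p) p :=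
  IsCyclotomicExtension.zeta_spec p ℤ_[p] (ZpTheta p)

theorem thetaSubOne_ne_zero (p : ℕ) [Fact p.Prime] : thetaSubOne p ≠ 0 :=
  sub_ne_zero.2 ((theta_isPrimitiveRoot p).ne_one (Fact.out : p.Prime).one_lt)

theorem algebraMap_padicInt_injective (p : ℕ) [Fact p.Prime] :
    Function.Injective (algebraMap ℤ_[p] (ZpTheta p)) :=
  FaithfulSMul.algebraMap_injective _ _

/-- `θ - 1` divides `Φ_p(1) - Φ_p(θ) = p`. -/
theorem thetaSubOne_dvd_prime (p : ℕ) [Fact p.Prime] : thetaSubOne p ∣ (p : ZpTheta p) := by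
  have h1 := Polynomial.sub_dvd_eval_sub (theta p : ZpTheta p) 1
    (Polynomial.cyclotomic p (ZpTheta p))
  have : CharZero (ZpTheta p) := charZero_of_injective_algebraMap (algebraMap_padicInt_injective p)
  have h2 : Polynomial.eval (theta p : ZpTheta p) (Polynomial.cyclotomic p (ZpTheta p)) = 0 :=
    (theta_isPrimitiveRoot p).isRoot_cyclotomic (Fact.out : p.Prime).pos
  rw [h2, Polynomial.eval_one_cyclotomic_prime, zero_sub, dvd_neg] at h1
  exact h1

/-- `θ - 1` is not a unit: its `p`-th power is divisible by `p`, which is not invertible in `ℤ_p` and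
hence not in the integral extension `ℤ_p[θ]`. -/
theorem not_isUnit_thetaSubOne (p : ℕ) [Fact p.Prime] : ¬ IsUnit (thetaSubOne p) := by
  intro h
  obtain ⟨r, hr⟩ := exists_add_pow_prime_eq (Fact.out : p.Prime) (thetaSubOne p) 1
  have hdvd : (p : ZpTheta p) ∣ thetaSubOne p ^ p := by
    have h1 : thetaSubOne p + 1 = theta p := sub_add_cancel _ _
    rw [h1, (theta_isPrimitiveRoot p).pow_eq_one, one_pow] at hr
    refine ⟨-(thetaSubOne p * r), ?_⟩
    linear_combination -hr
  have hunit := isUnit_of_dvd_unit hdvd (h.pow p)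
  have : Algebra.IsIntegral ℤ_[p] (ZpTheta p) := IsCyclotomicExtension.integral {p} _ _
  have h2 : IsUnit (algebraMap ℤ_[p] (ZpTheta p) p) := by rwa [map_natCast]
  exact PadicInt.p_nonunit (isUnit_of_map_unit (algebraMap ℤ_[p] (ZpTheta p)) _ h2)

/-- The residue ring of `ℤ_p[θ]` modulo `θ - 1` is a quotient of `ℤ_p`, since `θ` maps to `1`. -/
theorem card_quotient_thetaSubOne (p : ℕ) [Fact p.Prime] :
    Nat.card (ZpTheta p ⧸ Ideal.span {thetaSubOne p}) = p := by
  let f : ℤ_[p] →+* ZpTheta p ⧸ Ideal.span {thetaSubOne p} :=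
    (Ideal.Quotient.mk _).comp (algebraMap ℤ_[p] (ZpTheta p))
  have hsurj : Function.Surjective f := by
    intro y
    obtain ⟨x, rfl⟩ := Ideal.Quotient.mk_surjective y
    have hx : x ∈ Algebra.adjoin ℤ_[p] {(theta p : ZpTheta p)} := by
      rw [IsCyclotomicExtension.adjoin_primitive_root_eq_top (theta_isPrimitiveRoot p)]
      trivial
    have hθ : Ideal.Quotient.mk (Ideal.span {thetaSubOne p}) (theta p : ZpTheta p) = 1 := by
      rw [← map_one (Ideal.Quotient.mk _), Ideal.Quotient.eq]
      exact Ideal.mem_span_singleton_self _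
    induction hx using Algebra.adjoin_induction with
    | mem x hx =>
      rw [Set.mem_singleton_iff.1 hx, hθ]
      exact ⟨1, map_one f⟩
    | algebraMap r => exact ⟨r, rfl⟩
    | add x y _ _ hx hy =>
      obtain ⟨a, ha⟩ := hx
      obtain ⟨b, hb⟩ := hy
      exact ⟨a + b, by rw [map_add, map_add, ha, hb]⟩
    | mul x y _ _ hx hy =>
      obtain ⟨a, ha⟩ := hx
      obtain ⟨b, hb⟩ := hy
      exact ⟨a * b, by rw [map_mul, map_mul, ha, hb]⟩
  have hnt : Nontrivial (ZpTheta p ⧸ Ideal.span {thetaSubOne p}) :=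
    Ideal.Quotient.nontrivial_iff.2
      (fun h => not_isUnit_thetaSubOne p (Ideal.span_singleton_eq_top.1 h))
  have hker : RingHom.ker f = RingHom.ker (PadicInt.toZMod (p := p)) := by
    rw [PadicInt.ker_toZMod]
    refine ((IsLocalRing.maximalIdeal.isMaximal ℤ_[p]).eq_of_le (RingHom.ker_ne_top f) ?_).symm
    rw [PadicInt.maximalIdeal_eq_span_p, Ideal.span_singleton_le_iff_mem, RingHom.mem_ker]
    change Ideal.Quotient.mk _ (algebraMap ℤ_[p] (ZpTheta p) p) = 0
    rw [map_natCast, Ideal.Quotient.eq_zero_iff_mem, Ideal.mem_span_singleton]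
    exact thetaSubOne_dvd_prime p
  rw [← Nat.card_congr (RingHom.quotientKerEquivOfSurjective hsurj).toEquiv, hker,
    Nat.card_congr (RingHom.quotientKerEquivOfSurjective
      (ZMod.ringHom_surjective (PadicInt.toZMod (p := p)))).toEquiv, Nat.card_zmod]

/-- The ideal `(θ - 1) ^ n`, as a subgroup of the additive group written multiplicatively. -/
noncomputable def thetaPow (p : ℕ) [Fact p.Prime] (n : ℕ) : Subgroup (Multiplicative (ZpTheta p)) :=
  AddSubgroup.toSubgroup (Ideal.span {thetaSubOne p ^ n}).toAddSubgroup

theorem mem_thetaPow {p : ℕ} [Fact p.Prime] {n : ℕ} {x : Multiplicative (ZpTheta p)} :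
    x ∈ thetaPow p n ↔ thetaSubOne p ^ n ∣ x.toAdd := by
  change x.toAdd ∈ Ideal.span {thetaSubOne p ^ n} ↔ _
  exact Ideal.mem_span_singleton

/-- Multiplication by `θ - 1` is injective and maps `(θ - 1) ^ n` onto `(θ - 1) ^ (n + 1)`. -/
theorem index_thetaPow (p : ℕ) [Fact p.Prime] (n : ℕ) : (thetaPow p n).index = p ^ n := by
  let μ : Multiplicative (ZpTheta p) →* Multiplicative (ZpTheta p) :=
    AddMonoidHom.toMultiplicative (AddMonoidHom.mulLeft (thetaSubOne p))
  have hμ : ∀ x, (μ x).toAdd = thetaSubOne p * x.toAdd := fun _ => rfl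
  have hinj : Function.Injective μ := fun x y h => by
    have h1 := congrArg Multiplicative.toAdd h
    rw [hμ, hμ] at h1
    exact Multiplicative.toAdd.injective (mul_left_cancel₀ (thetaSubOne_ne_zero p) h1)
  have hmap : ∀ n, (thetaPow p n).map μ = thetaPow p (n + 1) := by
    intro n
    ext x
    rw [Subgroup.mem_map, mem_thetaPow]
    constructor
    · rintro ⟨y, hy, rfl⟩
      rw [hμ, pow_succ']
      exact mul_dvd_mul_left _ (mem_thetaPow.1 hy)
    · rintro ⟨r, hr⟩
      refine ⟨Multiplicative.ofAdd (thetaSubOne p ^ n * r), mem_thetaPow.2 ⟨r, rfl⟩, ?_⟩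
      refine Multiplicative.toAdd.injective ?_
      rw [hμ, hr, pow_succ']
      exact (mul_assoc _ _ _).symm
  have h0 : thetaPow p 0 = ⊤ := by
    refine Subgroup.ext fun x => ?_
    simp [mem_thetaPow]
  have h1 : μ.range.index = p := by
    rw [MonoidHom.range_eq_map, ← h0, hmap 0]
    have := card_quotient_thetaSubOne p
    rw [thetaPow, zero_add, pow_one]
    exact this
  induction n with
  | zero => rw [h0, Subgroup.index_top, pow_zero]
  | succ n ih => rw [← hmap, Subgroup.index_map_of_injective _ hinj, ih, h1, pow_succ]

/-! ### The lower central series of `ℤ_p[θ] ⋊ C_p` and its quotients -/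

theorem toAdd_thetaAut_apply (p : ℕ) [Fact p.Prime] (x : Multiplicative (ZpTheta p)) :
    (thetaAut p x).toAdd = theta p * x.toAdd := rfl

/-- The generator `g` of the cyclic factor, acting on `ℤ_p[θ]` as multiplication by `θ`. -/
noncomputable def thetaGen (p : ℕ) [Fact p.Prime] : Subgroup.zpowers (thetaAut p) :=
  ⟨thetaAut p, Subgroup.mem_zpowers _⟩

/-- Every element of the cyclic factor is multiplication by a power of `θ`, which is congruent to
`1` modulo `θ - 1`. -/
theorem exists_unit_of_mem_zpowers (p : ℕ) [Fact p.Prime] (σ : Subgroup.zpowers (thetaAut p)) :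
    ∃ u : ZpTheta p, thetaSubOne p ∣ u - 1 ∧
      ∀ x : Multiplicative (ZpTheta p), ((σ : MulAut _) x).toAdd = u * x.toAdd := by
  obtain ⟨σ, k, rfl⟩ := σ
  refine ⟨(theta p ^ k : (ZpTheta p)ˣ), ?_, fun x => ?_⟩
  · have h : Units.map (Ideal.Quotient.mk (Ideal.span {thetaSubOne p})).toMonoidHom (theta p) = 1 :=
      Units.ext (by
        change Ideal.Quotient.mk _ (theta p : ZpTheta p) = 1
        rw [← map_one (Ideal.Quotient.mk _), Ideal.Quotient.eq]
        exact Ideal.mem_span_singleton_self _)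
    have h2 := congrArg (fun u => (u ^ k : (ZpTheta p ⧸ Ideal.span {thetaSubOne p})ˣ).val) h
    simp only [← map_zpow, one_zpow] at h2
    rw [← Ideal.mem_span_singleton, ← Ideal.Quotient.eq, map_one]
    exact h2
  · induction k using Int.induction_on generalizing x with
    | zero => simp
    | succ n ih =>
      simp only [zpow_add_one, MulAut.mul_apply] at ih ⊢
      rw [ih, toAdd_thetaAut_apply, Units.val_mul, mul_assoc]
    | pred n ih =>
      simp only [zpow_sub_one, MulAut.mul_apply] at ih ⊢
      have h3 : ((thetaAut p)⁻¹ x).toAdd = (theta p)⁻¹ * x.toAdd := by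
        have := toAdd_thetaAut_apply p ((thetaAut p)⁻¹ x)
        rw [MulAut.apply_inv_self] at this
        rw [this, Units.inv_mul_cancel_left]
      rw [ih, h3, Units.val_mul, mul_assoc]

theorem card_zpowers_thetaAut (p : ℕ) [Fact p.Prime] :
    Nat.card (Subgroup.zpowers (thetaAut p)) = p := by
  have hpow : ∀ (n : ℕ) x, ((thetaAut p ^ n) x).toAdd = (theta p : ZpTheta p) ^ n * x.toAdd := by
    intro n
    induction n with
    | zero => intro x; simp
    | succ n ih => intro x; rw [pow_succ, MulAut.mul_apply, ih, toAdd_thetaAut_apply]; ring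
  rw [Nat.card_zpowers]
  refine orderOf_eq_prime (MulEquiv.ext fun x => Multiplicative.toAdd.injective ?_) fun h => ?_
  · rw [hpow, (theta_isPrimitiveRoot p).pow_eq_one, one_mul]
    rfl
  · have h1 := toAdd_thetaAut_apply p (Multiplicative.ofAdd 1)
    rw [h, MulAut.one_apply, toAdd_ofAdd, mul_one] at h1
    exact (theta_isPrimitiveRoot p).ne_one (Fact.out : p.Prime).one_lt h1.symm

theorem MInfty.commutatorElement_eq (p : ℕ) [Fact p.Prime] (x y : MInfty p) :
    ⁅x, y⁆ = SemidirectProduct.inl (x.left * (x.right : MulAut _) y.left *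
      ((y.right : MulAut _) x.left)⁻¹ * y.left⁻¹) := by
  have hcomm : x.right * y.right = y.right * x.right := by
    obtain ⟨k, hk⟩ := x.right.2
    obtain ⟨l, hl⟩ := y.right.2
    refine Subtype.ext ?_
    rw [Subgroup.coe_mul, Subgroup.coe_mul, ← hk, ← hl]
    exact ((Commute.refl (thetaAut p)).zpow_zpow k l).eq
  rw [commutatorElement_def, mul_inv_eq_iff_eq_mul, mul_inv_eq_iff_eq_mul]
  ext
  · simp only [SemidirectProduct.mul_left, SemidirectProduct.mul_right,
      SemidirectProduct.left_inl, SemidirectProduct.right_inl, Subgroup.coe_subtype,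
      map_one, MulAut.one_apply, one_mul]
    congr 1
    rw [mul_assoc, mul_assoc, inv_mul_cancel_left, mul_assoc, inv_mul_cancel, mul_one]
  · rw [SemidirectProduct.mul_right, SemidirectProduct.mul_right, SemidirectProduct.mul_right,
      SemidirectProduct.right_inl, one_mul, hcomm]

/-- For `n ≥ 1` the term `γ_{n+1}` of `ℤ_p[θ] ⋊ C_p` is the ideal `(θ - 1) ^ n`. -/
theorem MInfty.lowerCentralSeries_eq (p : ℕ) [Fact p.Prime] (n : ℕ) :
    (⊤ : Subgroup (MInfty p)).lowerCentralSeries (n + 1) =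
      (thetaPow p (n + 1)).map SemidirectProduct.inl := by
  have hge : ∀ n, (thetaPow p n).map SemidirectProduct.inl ≤
      (⊤ : Subgroup (MInfty p)).lowerCentralSeries n →
      (thetaPow p (n + 1)).map SemidirectProduct.inl ≤
      (⊤ : Subgroup (MInfty p)).lowerCentralSeries (n + 1) := by
    rintro n hn _ ⟨x, hx, rfl⟩
    obtain ⟨r, hr⟩ := mem_thetaPow.1 hx
    rw [Subgroup.lowerCentralSeries_succ]
    have hmem : Multiplicative.ofAdd (-(thetaSubOne p ^ n * r)) ∈ thetaPow p n :=
      mem_thetaPow.2 (Dvd.dvd.neg_right ⟨r, rfl⟩)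
    have := Subgroup.commutator_mem_commutator (hn ⟨_, hmem, rfl⟩)
      (Subgroup.mem_top (SemidirectProduct.inr (thetaGen p) : MInfty p))
    rw [MInfty.commutatorElement_eq] at this
    convert this using 2
    refine Multiplicative.toAdd.injective ?_
    simp only [SemidirectProduct.left_inl, SemidirectProduct.right_inl, SemidirectProduct.left_inr,
      SemidirectProduct.right_inr, toAdd_mul, toAdd_inv, thetaGen, toAdd_thetaAut_apply, map_one,
      toAdd_one, toAdd_ofAdd, hr]
    have hθ : (theta p : ZpTheta p) = thetaSubOne p + 1 := (sub_add_cancel _ _).symm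
    rw [hθ]
    ring
  induction n with
  | zero =>
    refine le_antisymm ?_ (hge 0 le_top)
    rw [Subgroup.lowerCentralSeries_succ, Subgroup.commutator_le]
    intro x _ y _
    rw [MInfty.commutatorElement_eq]
    refine Subgroup.mem_map_of_mem _ (mem_thetaPow.2 ?_)
    obtain ⟨u, ⟨s, hu⟩, hux⟩ := exists_unit_of_mem_zpowers p x.right
    obtain ⟨v, ⟨t, hv⟩, hvx⟩ := exists_unit_of_mem_zpowers p y.right
    refine ⟨s * y.left.toAdd - t * x.left.toAdd, ?_⟩
    simp only [toAdd_mul, toAdd_inv, hux, hvx, zero_add, pow_one]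
    linear_combination y.left.toAdd * hu - x.left.toAdd * hv
  | succ n ih =>
    refine le_antisymm ?_ (hge (n + 1) ih.ge)
    rw [Subgroup.lowerCentralSeries_succ, ih, Subgroup.commutator_le]
    rintro _ ⟨x, hx, rfl⟩ y _
    rw [MInfty.commutatorElement_eq]
    refine Subgroup.mem_map_of_mem _ (mem_thetaPow.2 ?_)
    obtain ⟨r, hr⟩ := mem_thetaPow.1 hx
    obtain ⟨v, ⟨t, hv⟩, hvx⟩ := exists_unit_of_mem_zpowers p y.right
    refine ⟨-(t * r), ?_⟩
    simp only [SemidirectProduct.left_inl, SemidirectProduct.right_inl, Subgroup.coe_one,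
      MulAut.one_apply, toAdd_mul, toAdd_inv, hvx, hr]
    linear_combination -(thetaSubOne p ^ (n + 1) * r) * hv

theorem MInfty.index_range_inl (p : ℕ) [Fact p.Prime] :
    (SemidirectProduct.inl : Multiplicative (ZpTheta p) →* MInfty p).range.index = p := by
  rw [SemidirectProduct.range_inl_eq_ker_rightHom, Subgroup.index_ker,
    MonoidHom.range_eq_top.2 SemidirectProduct.rightHom_surjective, Subgroup.card_top,
    card_zpowers_thetaAut]

theorem MInfty.index_lowerCentralSeries (p : ℕ) [Fact p.Prime] (n : ℕ) :
    ((⊤ : Subgroup (MInfty p)).lowerCentralSeries (n + 1)).index = p ^ (n + 2) := by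
  rw [MInfty.lowerCentralSeries_eq, Subgroup.index_map_of_injective _
    SemidirectProduct.inl_injective, index_thetaPow, MInfty.index_range_inl, pow_succ p (n + 1)]

section MQuot

variable (p : ℕ) [Fact p.Prime] (k : ℕ)

theorem MQuot.lowerCentralSeries_eq (i n : ℕ) :
    (⊤ : Subgroup (MQuot p i)).lowerCentralSeries n =
      ((⊤ : Subgroup (MInfty p)).lowerCentralSeries n).map (QuotientGroup.mk' _) := by
  rw [Subgroup.map_lowerCentralSeries, Subgroup.map_top_of_surjective _
    (QuotientGroup.mk'_surjective _)]

theorem MQuot.card_eq : Nat.card (MQuot p (k + 2)) = p ^ (k + 2) :=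
  MInfty.index_lowerCentralSeries p k

theorem MQuot.finite : Finite (MQuot p (k + 2)) :=
  Nat.finite_of_card_ne_zero (by
    rw [MQuot.card_eq]
    exact pow_ne_zero _ (Fact.out : p.Prime).ne_zero)

theorem MQuot.mk_inl_eq_one_iff (x : Multiplicative (ZpTheta p)) :
    (QuotientGroup.mk (SemidirectProduct.inl x) : MQuot p (k + 2)) = 1 ↔
      thetaSubOne p ^ (k + 1) ∣ x.toAdd := by
  rw [QuotientGroup.eq_one_iff, show k + 2 - 1 = k + 1 from rfl, MInfty.lowerCentralSeries_eq,
    ← mem_thetaPow]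
  exact Subgroup.mem_map_iff_mem SemidirectProduct.inl_injective

theorem MQuot.nilpotencyClass_eq : Group.nilpotencyClass (MQuot p (k + 2)) = k + 1 := by
  have hbot : (⊤ : Subgroup (MQuot p (k + 2))).lowerCentralSeries (k + 1) = ⊥ := by
    rw [MQuot.lowerCentralSeries_eq, Subgroup.map_eq_bot_iff, QuotientGroup.ker_mk']
    exact le_rfl
  have hnil : Group.IsNilpotent (MQuot p (k + 2)) :=
    Subgroup.nilpotent_iff_lowerCentralSeries.2 ⟨_, hbot⟩
  refine le_antisymm (Subgroup.lowerCentralSeries_eq_bot_iff_nilpotencyClass_le.1 hbot) ?_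
  by_contra hlt
  have h := Subgroup.lowerCentralSeries_eq_bot_iff_nilpotencyClass_le.2
    (Nat.lt_succ_iff.1 (not_le.1 hlt))
  rw [MQuot.lowerCentralSeries_eq, Subgroup.map_eq_bot_iff, QuotientGroup.ker_mk'] at h
  have h1 := Subgroup.index_dvd_of_le h
  rw [show k + 2 - 1 = k + 1 from rfl, MInfty.index_lowerCentralSeries] at h1
  have hp : p.Prime := Fact.out
  cases k with
  | zero =>
    rw [Subgroup.lowerCentralSeries_zero, Subgroup.index_top, Nat.dvd_one] at h1
    exact absurd h1 (Nat.one_lt_pow (by omega) hp.one_lt).ne'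
  | succ k =>
    rw [MInfty.index_lowerCentralSeries] at h1
    exact absurd (Nat.le_of_dvd (pow_pos hp.pos _) h1)
      (not_le.2 (Nat.pow_lt_pow_right hp.one_lt (by omega)))

theorem MQuot.commutator_eq : commutator (MQuot p (k + 2)) =
    ((thetaPow p 1).map (SemidirectProduct.inl : _ →* MInfty p)).map (QuotientGroup.mk' _) := by
  rw [← Subgroup.top_lowerCentralSeries_one, MQuot.lowerCentralSeries_eq,
    MInfty.lowerCentralSeries_eq]

theorem MQuot.card_commutator : Nat.card (commutator (MQuot p (k + 2))) = p ^ k := by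
  have hp : p.Prime := Fact.out
  have hidx : (commutator (MQuot p (k + 2))).index = p ^ 2 := by
    rw [← Subgroup.top_lowerCentralSeries_one, MQuot.lowerCentralSeries_eq,
      Subgroup.index_map_eq _ (QuotientGroup.mk'_surjective _), MInfty.index_lowerCentralSeries]
    rw [QuotientGroup.ker_mk']
    exact Subgroup.lowerCentralSeries_antitone _ (by omega)
  have h := (commutator (MQuot p (k + 2))).card_mul_index
  rw [hidx, MQuot.card_eq, pow_add] at h
  exact Nat.eq_of_mul_eq_mul_right (pow_pos hp.pos 2) h

/-- The image of `ℤ_p[θ]` is an abelian subgroup of index `p`. The class of the generator `g` is the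
whole coset `G' g`, because `h g h⁻¹ = h ^ (1 - θ) g`. -/
theorem MQuot.isStemMonomial : IsStemMonomial p (MQuot p (k + 3)) (k + 1) 1 := by
  have hp : p.Prime := Fact.out
  have := MQuot.finite p (k + 1)
  let A : Subgroup (MQuot p (k + 3)) :=
    (SemidirectProduct.inl : Multiplicative (ZpTheta p) →* MInfty p).range.map (QuotientGroup.mk' _)
  have hnormal : A.Normal := by
    have : (SemidirectProduct.inl : Multiplicative (ZpTheta p) →* MInfty p).range.Normal := by
      rw [SemidirectProduct.range_inl_eq_ker_rightHom]
      infer_instance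
    exact this.map _ (QuotientGroup.mk'_surjective _)
  have hcomm : ∀ a ∈ A, ∀ b ∈ A, Commute a b := by
    rintro _ ⟨_, ⟨a, rfl⟩, rfl⟩ _ ⟨_, ⟨b, rfl⟩, rfl⟩
    rw [commute_iff_eq, ← map_mul, ← map_mul, ← map_mul, ← map_mul, mul_comm]
  have hindex : A.index = p := by
    rw [Subgroup.index_map_eq _ (QuotientGroup.mk'_surjective _), MInfty.index_range_inl]
    rw [QuotientGroup.ker_mk', show k + 3 - 1 = (k + 1) + 1 from rfl, MInfty.lowerCentralSeries_eq]
    exact Subgroup.map_le_range _ _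
  let g : MQuot p (k + 3) := QuotientGroup.mk (SemidirectProduct.inr (thetaGen p))
  have hθ : (theta p : ZpTheta p) = thetaSubOne p + 1 := (sub_add_cancel _ _).symm
  have hbracket : ∀ a : Multiplicative (ZpTheta p),
      ⁅(QuotientGroup.mk (SemidirectProduct.inl a) : MQuot p (k + 3)), g⁆ = QuotientGroup.mk
        (SemidirectProduct.inl (Multiplicative.ofAdd (-(thetaSubOne p * a.toAdd)))) := by
    intro a
    have h1 : ⁅(SemidirectProduct.inl a : MInfty p), (SemidirectProduct.inr (thetaGen p) : MInfty p)⁆ =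
        SemidirectProduct.inl (Multiplicative.ofAdd (-(thetaSubOne p * a.toAdd))) := by
      rw [MInfty.commutatorElement_eq]
      congr 1
      refine Multiplicative.toAdd.injective ?_
      simp only [SemidirectProduct.left_inl, SemidirectProduct.right_inl,
        SemidirectProduct.left_inr, SemidirectProduct.right_inr, toAdd_mul, toAdd_inv, thetaGen,
        toAdd_thetaAut_apply, map_one, toAdd_one, toAdd_ofAdd, hθ]
      ring
    rw [← h1]
    rfl
  have hdvd : ∀ a : Multiplicative (ZpTheta p),
      Commute (QuotientGroup.mk (SemidirectProduct.inl a) : MQuot p (k + 3)) g →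
      thetaSubOne p ^ (k + 1) ∣ a.toAdd := by
    intro a ha
    have h1 := hbracket a
    rw [commutatorElement_eq_one_iff_commute.2 ha] at h1
    have h2 := (MQuot.mk_inl_eq_one_iff p (k + 1) _).1 h1.symm
    rw [toAdd_ofAdd, dvd_neg, pow_succ'] at h2
    exact (mul_dvd_mul_iff_left (thetaSubOne_ne_zero p)).1 h2
  have hncent : ¬ A ≤ Subgroup.center _ := by
    intro hle
    have h1 := Subgroup.mem_center_iff.1
      (hle ⟨_, ⟨Multiplicative.ofAdd 1, rfl⟩, rfl⟩) g
    have h2 := hdvd (Multiplicative.ofAdd 1) h1.symm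
    exact not_isUnit_thetaSubOne p
      (isUnit_of_dvd_one ((dvd_pow_self _ k.succ_ne_zero).trans h2))
  obtain ⟨χ, hχ⟩ := exists_isSelfStabilizing_of_prime_index A hcomm hindex hncent
  refine ⟨inferInstance, IsPGroup.of_card (MQuot.card_eq p (k + 1)), fun z hz => ?_, fun x => ?_,
    ⟨g, ?_⟩, A, χ, hχ, hcomm, by rw [hindex, pow_one]⟩
  · -- central elements fix `χ`, hence lie in `A`
    have hzA : z ∈ A := hχ.stabilizer_le z fun a _ => by
      rw [mul_assoc, Subgroup.mem_center_iff.1 hz a, inv_mul_cancel_left]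
    obtain ⟨_, ⟨a, rfl⟩, rfl⟩ := hzA
    rw [MQuot.commutator_eq p (k + 1)]
    refine Subgroup.mem_map_of_mem _ (Subgroup.mem_map_of_mem _ (mem_thetaPow.2 ?_))
    rw [pow_one]
    exact (dvd_pow_self _ k.succ_ne_zero).trans
      (hdvd a (Subgroup.mem_center_iff.1 hz g).symm)
  · rw [← MQuot.card_commutator p (k + 1)]
    exact card_conjugatesOf_le_card_commutator x
  · refine le_antisymm ?_ ?_
    · rw [← MQuot.card_commutator p (k + 1)]
      exact card_conjugatesOf_le_card_commutator g
    · rw [← MQuot.card_commutator p (k + 1)]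
      refine Nat.card_le_card_of_injective (fun c => ⟨(c : MQuot p (k + 3)) * g, ?_⟩)
        fun c d hcd => Subtype.ext (mul_right_cancel (congrArg Subtype.val hcd))
      obtain ⟨c, hc⟩ := c
      rw [MQuot.commutator_eq p (k + 1)] at hc
      obtain ⟨_, ⟨x, hx, rfl⟩, rfl⟩ := hc
      obtain ⟨r, hr⟩ := mem_thetaPow.1 hx
      rw [conjugatesOf_eq_range]
      refine ⟨QuotientGroup.mk (SemidirectProduct.inl (Multiplicative.ofAdd (-r))), ?_⟩
      have h1 := hbracket (Multiplicative.ofAdd (-r))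
      rw [toAdd_ofAdd, mul_neg, neg_neg, ← pow_one (thetaSubOne p), ← hr, ofAdd_toAdd,
        commutatorElement_def, mul_inv_eq_iff_eq_mul] at h1
      exact h1

end MQuot

/-! ### Central extensions defined by a biadditive map -/

/-- The central extension of `V` by `W` with cocycle the biadditive map `β`: the set `V × W` with
`(v, w) (v', w') = (v + v', w + w' + β v v')`. -/
@[ext]
structure BilinExt {V W : Type*} [AddCommGroup V] [AddCommGroup W] (β : V →+ V →+ W) where
  /-- The component in the quotient `V`. -/
  fst : V
  /-- The component in the central subgroup `W`. -/
  snd : W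

namespace BilinExt

variable {V W : Type*} [AddCommGroup V] [AddCommGroup W] (β : V →+ V →+ W)

instance : Mul (BilinExt β) := ⟨fun x y => ⟨x.fst + y.fst, x.snd + y.snd + β x.fst y.fst⟩⟩

instance : One (BilinExt β) := ⟨⟨0, 0⟩⟩

instance : Inv (BilinExt β) := ⟨fun x => ⟨-x.fst, -x.snd + β x.fst x.fst⟩⟩

@[simp] theorem fst_mul (x y : BilinExt β) : (x * y).fst = x.fst + y.fst := rfl
@[simp] theorem snd_mul (x y : BilinExt β) : (x * y).snd = x.snd + y.snd + β x.fst y.fst := rfl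
@[simp] theorem fst_one : (1 : BilinExt β).fst = 0 := rfl
@[simp] theorem snd_one : (1 : BilinExt β).snd = 0 := rfl
@[simp] theorem fst_inv (x : BilinExt β) : x⁻¹.fst = -x.fst := rfl
@[simp] theorem snd_inv (x : BilinExt β) : x⁻¹.snd = -x.snd + β x.fst x.fst := rfl

instance : Group (BilinExt β) :=
  Group.ofLeftAxioms
    (fun x y z => by
      ext
      · simp [add_assoc]
      · simp only [snd_mul, fst_mul, map_add, AddMonoidHom.add_apply]
        abel)
    (fun x => by ext <;> simp)
    (fun x => by ext <;> simp)

/-- The underlying set is `V × W`. -/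
def equivProd : BilinExt β ≃ V × W where
  toFun x := (x.fst, x.snd)
  invFun x := ⟨x.1, x.2⟩
  left_inv _ := rfl
  right_inv _ := rfl

theorem card_eq : Nat.card (BilinExt β) = Nat.card V * Nat.card W := by
  rw [Nat.card_congr (equivProd β), Nat.card_prod]

instance [Finite V] [Finite W] : Finite (BilinExt β) := Finite.of_equiv _ (equivProd β).symm

/-- The projection to `V`. -/
def proj : BilinExt β →* Multiplicative V where
  toFun x := Multiplicative.ofAdd x.fst
  map_one' := rfl
  map_mul' _ _ := rfl

/-- The inclusion of `W`. -/
def incl : Multiplicative W →* BilinExt β where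
  toFun w := ⟨0, w.toAdd⟩
  map_one' := rfl
  map_mul' _ _ := by ext <;> simp

theorem proj_surjective : Function.Surjective (proj β) := fun v => ⟨⟨v.toAdd, 0⟩, rfl⟩

theorem mem_ker_proj {x : BilinExt β} : x ∈ (proj β).ker ↔ x.fst = 0 := Iff.rfl

/-- The alternating map `(v, v') ↦ β v v' - β v' v`, which describes commutators. -/
def alt : V →+ V →+ W := β - β.flip

theorem alt_apply (v v' : V) : alt β v v' = β v v' - β v' v := rfl

theorem alt_swap (v v' : V) : alt β v v' = -alt β v' v := by
  rw [alt_apply, alt_apply, neg_sub]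

theorem conj_eq (x y : BilinExt β) : x * y * x⁻¹ = ⟨y.fst, y.snd + alt β x.fst y.fst⟩ := by
  ext
  · simp
  · simp only [snd_mul, fst_mul, snd_inv, fst_inv, map_add, AddMonoidHom.add_apply, map_neg,
      alt_apply]
    abel

theorem commutatorElement_eq (x y : BilinExt β) : ⁅x, y⁆ = ⟨0, alt β x.fst y.fst⟩ := by
  rw [commutatorElement_def, conj_eq]
  ext
  · simp
  · simp only [snd_mul, snd_inv, fst_inv, map_neg]
    abel

/-- A class is the translate of the range of `alt β v`. -/
theorem card_conjugatesOf (x : BilinExt β) :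
    Nat.card (conjugatesOf x) = Nat.card (alt β x.fst).range := by
  have hinj : Function.Injective (fun s : W => (⟨x.fst, x.snd - s⟩ : BilinExt β)) := fun s t h =>
    sub_right_injective (congrArg BilinExt.snd h)
  have h : conjugatesOf x =
      (fun s : W => (⟨x.fst, x.snd - s⟩ : BilinExt β)) '' ((alt β x.fst).range : Set W) := by
    rw [conjugatesOf_eq_range]
    ext y
    simp only [Set.mem_range, Set.mem_image, SetLike.mem_coe, AddMonoidHom.mem_range,
      exists_exists_eq_and, conj_eq]
    constructor
    · rintro ⟨z, rfl⟩
      exact ⟨z.fst, by rw [alt_swap, sub_neg_eq_add]⟩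
    · rintro ⟨v, rfl⟩
      exact ⟨⟨v, 0⟩, by rw [alt_swap β v, sub_eq_add_neg]⟩
  rw [h, Nat.card_image_of_injective hinj]
  rfl

theorem mem_center_iff {x : BilinExt β} : x ∈ Subgroup.center (BilinExt β) ↔ alt β x.fst = 0 := by
  rw [Subgroup.mem_center_iff]
  constructor
  · intro h
    ext v
    have := commutatorElement_eq β x ⟨v, 0⟩
    rw [commutatorElement_eq_one_iff_mul_comm.2 (h _).symm] at this
    exact (congrArg BilinExt.snd this).symm
  · intro h y
    refine (commutatorElement_eq_one_iff_mul_comm.1 ?_).symm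
    rw [commutatorElement_eq, h]
    rfl

/-- If the values of `alt β` generate `W`, then `W` is the derived subgroup. -/
theorem commutator_eq (hspan : AddSubgroup.closure {w | ∃ a b, alt β a b = w} = ⊤) :
    commutator (BilinExt β) = (proj β).ker := by
  refine le_antisymm ?_ fun x hx => ?_
  · rw [commutator_def, Subgroup.commutator_le]
    intro x _ y _
    rw [commutatorElement_eq]
    exact (mem_ker_proj β).2 rfl
  · have hw : ∀ w : W, incl β (Multiplicative.ofAdd w) ∈ commutator (BilinExt β) := by
      intro w
      have hmem : w ∈ AddSubgroup.closure {w | ∃ a b, alt β a b = w} := hspan ▸ AddSubgroup.mem_top w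
      induction hmem using AddSubgroup.closure_induction with
      | mem w h =>
        obtain ⟨a, b, rfl⟩ := h
        have := Subgroup.commutator_mem_commutator
          (Subgroup.mem_top (⟨a, 0⟩ : BilinExt β)) (Subgroup.mem_top (⟨b, 0⟩ : BilinExt β))
        rw [commutatorElement_eq] at this
        exact this
      | zero => rw [ofAdd_zero, map_one]; exact Subgroup.one_mem _
      | add w w' _ _ h h' => rw [ofAdd_add, map_mul]; exact Subgroup.mul_mem _ h h'
      | neg w _ h => rw [ofAdd_neg, map_inv]; exact Subgroup.inv_mem _ h
    have h1 : x = incl β (Multiplicative.ofAdd x.snd) := BilinExt.ext ((mem_ker_proj β).1 hx) rfl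
    rw [h1]
    exact hw _

theorem pow_eq (x : BilinExt β) (n : ℕ) :
    x ^ n = ⟨n • x.fst, n • x.snd + (n.choose 2) • β x.fst x.fst⟩ := by
  induction n with
  | zero => ext <;> simp
  | succ n ih =>
    rw [pow_succ, ih]
    ext
    · simp [succ_nsmul]
    · rw [snd_mul]
      have h : (n + 1).choose 2 = n + n.choose 2 := by
        rw [Nat.choose_succ_succ' n 1, Nat.choose_one_right]
      rw [h]
      simp only [map_nsmul, AddMonoidHom.nsmul_apply, add_nsmul, one_nsmul]
      abel

theorem center_eq (hβ : ∀ v, v ≠ 0 → alt β v ≠ 0) :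
    Subgroup.center (BilinExt β) = (proj β).ker := by
  ext x
  rw [mem_center_iff, mem_ker_proj]
  constructor
  · exact fun h => by_contra fun hx => hβ _ hx h
  · intro h
    rw [h, map_zero]

/-- If the form obtained from `β` and a character `ψ` of `W` has the kernel of `L` as a maximal
isotropic subgroup on which `β` itself is trivial modulo `ψ`, then `ψ` extends to a linear character
of the preimage of `ker L`, and this character is its own stabilizer. -/
theorem isSelfStabilizing {U : Type*} [AddCommGroup U] (L : V →+ U) (ψ : AddChar W ℂ)
    (h1 : ∀ a b, L a = 0 → L b = 0 → ψ (β a b) = 1)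
    (h2 : ∀ v, (∀ a, L a = 0 → ψ (alt β v a) = 1) → L v = 0) :
    IsSelfStabilizing ((AddMonoidHom.toMultiplicative L).comp (proj β)).ker (fun x => ψ x.snd) where
  normal := inferInstance
  map_one := ψ.map_zero_eq_one
  map_mul := fun a ha b hb => by
    rw [snd_mul, ψ.map_add_eq_mul, ψ.map_add_eq_mul, h1 a.fst b.fst ha hb, mul_one]
  stabilizer_le := fun g hg => by
    refine h2 g.fst fun a ha => ?_
    have := hg ⟨-a, 0⟩ (by
      change L (-a) = 0
      rw [map_neg, ha, neg_zero])
    have hc := conj_eq β g⁻¹ ⟨-a, 0⟩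
    rw [inv_inv] at hc
    rw [hc] at this
    simpa using this

/-- When the range of `alt β v` has order `p ^ b` for every `v ≠ 0`, both the center and the derived
subgroup are `W`. The degrees are at most `p ^ ⌊m / 2⌋` because the center has index `p ^ m`, and
this bound is attained if the isotropic subgroup `ker L` has index `p ^ ⌊m / 2⌋`. -/
theorem isStemPGroupOfType {p b m n : ℕ} [Fact p.Prime] (hV : Nat.card V = p ^ m)
    (hW : Nat.card W = p ^ n) (hb : 1 ≤ b) (hm : 1 ≤ m)
    (hβ : ∀ v, v ≠ 0 → Nat.card (alt β v).range = p ^ b)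
    (hspan : AddSubgroup.closure {w | ∃ a b, alt β a b = w} = ⊤)
    {U : Type*} [AddCommGroup U] (L : V →+ U) (hL : Function.Surjective L)
    (hU : Nat.card U = p ^ (m / 2)) (ψ : AddChar W ℂ)
    (h1 : ∀ a b, L a = 0 → L b = 0 → ψ (β a b) = 1)
    (h2 : ∀ v, (∀ a, L a = 0 → ψ (alt β v a) = 1) → L v = 0) :
    IsStemPGroupOfType p (BilinExt β) b (m / 2) ∧
      Subgroup.center (BilinExt β) = (proj β).ker ∧ commutator (BilinExt β) = (proj β).ker ∧
      Nat.card (BilinExt β) = p ^ (m + n) := by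
  have hp : p.Prime := Fact.out
  have : Finite V := Nat.finite_of_card_ne_zero (hV ▸ pow_ne_zero _ hp.ne_zero)
  have : Finite W := Nat.finite_of_card_ne_zero (hW ▸ pow_ne_zero _ hp.ne_zero)
  have hcard : Nat.card (BilinExt β) = p ^ (m + n) := by rw [card_eq, hV, hW, pow_add]
  have hpG : IsPGroup p (BilinExt β) := IsPGroup.of_card hcard
  have hcenter := center_eq β fun v hv h0 => by
    have h3 := hβ v hv
    rw [h0] at h3
    have h4 : (0 : V →+ W).range = ⊥ := (AddMonoidHom.range_eq_bot_iff).2 rfl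
    rw [h4, AddSubgroup.card_bot] at h3
    exact absurd h3 (Nat.one_lt_pow (by omega) hp.one_lt).ne
  have hcomm := commutator_eq β hspan
  have hcomp : Function.Surjective ((AddMonoidHom.toMultiplicative L).comp (proj β)) :=
    Function.Surjective.comp (g := AddMonoidHom.toMultiplicative L) hL (proj_surjective β)
  refine ⟨⟨inferInstance, hpG, (hcenter.trans hcomm.symm).le,
    isBreadth_of_bounds (fun x => ?_) ?_, isRepExponent_of_bounds (fun k ρ hρ => ?_) ?_⟩,
    hcenter, hcomm, hcard⟩
  · rw [card_conjugatesOf]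
    by_cases hx : x.fst = 0
    · have h4 : (alt β x.fst).range = ⊥ := by
        rw [hx, map_zero]
        exact (AddMonoidHom.range_eq_bot_iff).2 rfl
      rw [h4, AddSubgroup.card_bot]
      exact Nat.one_le_pow _ _ hp.pos
    · exact (hβ _ hx).le
  · have : Nontrivial V := Finite.one_lt_card_iff_nontrivial.1
      (hV ▸ Nat.one_lt_pow (by omega) hp.one_lt)
    obtain ⟨v, hv⟩ := exists_ne (0 : V)
    exact ⟨⟨v, 0⟩, by rw [card_conjugatesOf, hβ v hv]⟩
  · have := hρ.finrank_le_of_class_two hpG (hcomm.trans hcenter.symm).le (m := m) (by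
      rw [hcenter, Subgroup.index_ker, MonoidHom.range_eq_top.2 (proj_surjective β),
        Subgroup.card_top]
      exact hV)
    rwa [Module.finrank_fin_fun] at this
  · obtain ⟨k, σ, hσ, hk⟩ := (isSelfStabilizing β L ψ h1 h2).exists_irreducible
    refine ⟨k, σ, hσ, le_trans (le_of_eq ?_) hk⟩
    rw [Subgroup.index_ker, MonoidHom.range_eq_top.2 hcomp, Subgroup.card_top, ← hU]
    rfl

end BilinExt

/-! ### Transport along isomorphisms -/

theorem card_conjugatesOf_mulEquiv {G H : Type*} [Group G] [Group H] (e : G ≃* H) (g : G) :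
    Nat.card (conjugatesOf (e g)) = Nat.card (conjugatesOf g) := by
  have h : conjugatesOf (e g) = e '' conjugatesOf g := by
    rw [conjugatesOf_eq_range, conjugatesOf_eq_range, ← Set.range_comp,
      ← e.surjective.range_comp]
    congr 1
    ext x
    simp
  rw [h, Nat.card_image_of_injective e.injective]

theorem map_commutator_mulEquiv {G H : Type*} [Group G] [Group H] (e : G ≃* H) :
    (commutator G).map e.toMonoidHom = commutator H := by
  rw [commutator_def, commutator_def, Subgroup.map_commutator,
    Subgroup.map_top_of_surjective _ e.surjective]

theorem map_center_mulEquiv {G H : Type*} [Group G] [Group H] (e : G ≃* H) :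
    (Subgroup.center G).map e.toMonoidHom = Subgroup.center H := by
  ext x
  rw [Subgroup.mem_map, Subgroup.mem_center_iff]
  constructor
  · rintro ⟨z, hz, rfl⟩ y
    have := congrArg e (Subgroup.mem_center_iff.1 hz (e.symm y))
    simpa using this
  · intro hx
    refine ⟨e.symm x, Subgroup.mem_center_iff.2 fun y => e.injective ?_, by simp⟩
    simpa using hx (e y)

theorem exists_mem_Irr_of_mulEquiv {G H : Type*} [Group G] [Group H] (e : G ≃* H) {m : ℕ}
    (h : ∃ χ ∈ Irr G, χ 1 = m) : ∃ χ ∈ Irr H, χ 1 = m := by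
  obtain ⟨_, ⟨n, ρ, hρ, rfl⟩, hm⟩ := h
  have hσ : Representation.IsIrreducible (G := H) (ρ.comp e.symm.toMonoidHom) :=
    hρ.of_linearEquiv _ (LinearEquiv.refl ℂ _) e.symm.toMonoidHom e.symm.surjective
      fun _ _ => rfl
  refine ⟨_, ⟨n, _, hσ, rfl⟩, ?_⟩
  rw [Representation.char_one] at hm ⊢
  exact hm

theorem IsStemPGroupOfType.of_mulEquiv {p b d : ℕ} {G H : Type*} [Group G] [Group H]
    (h : IsStemPGroupOfType p G b d) (e : G ≃* H) : IsStemPGroupOfType p H b d := by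
  have := h.finite
  refine ⟨Finite.of_equiv _ e.toEquiv, h.isPGroup.of_equiv e, ?_, ?_, ?_⟩
  · rw [IsStem, ← map_center_mulEquiv e, ← map_commutator_mulEquiv e]
    exact Subgroup.map_mono h.isStem
  · have hset : {n : ℕ | ∃ g : H, Nat.card (conjugatesOf g) = p ^ n} =
        {n : ℕ | ∃ g : G, Nat.card (conjugatesOf g) = p ^ n} := by
      ext n
      constructor
      · rintro ⟨g, hg⟩
        exact ⟨e.symm g, by rw [card_conjugatesOf_mulEquiv, hg]⟩
      · rintro ⟨g, hg⟩
        exact ⟨e g, by rw [card_conjugatesOf_mulEquiv, hg]⟩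
    rw [IsBreadth, hset]
    exact h.hasType.1
  · have hset : {m : ℕ | ∃ χ ∈ Irr H, χ 1 = m} = {m : ℕ | ∃ χ ∈ Irr G, χ 1 = m} :=
      Set.ext fun m => ⟨exists_mem_Irr_of_mulEquiv e.symm, exists_mem_Irr_of_mulEquiv e⟩
    rw [IsRepExponent, hset]
    exact h.hasType.2

/-! ### Unitriangular matrices and their central quotients -/

/-- The biadditive map `((a, b), (a', b')) ↦ q (a b')` on `K × K`. -/
def mulForm {K W : Type*} [Field K] [AddCommGroup W] (q : K →+ W) : K × K →+ K × K →+ W :=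
  (AddMonoidHom.compr₂ AddMonoidHom.mul q).compl₂ (AddMonoidHom.snd K K) |>.comp
    (AddMonoidHom.fst K K)

theorem mulForm_apply {K W : Type*} [Field K] [AddCommGroup W] (q : K →+ W) (v v' : K × K) :
    mulForm q v v' = q (v.1 * v'.2) := rfl

theorem alt_mulForm_apply {K W : Type*} [Field K] [AddCommGroup W] (q : K →+ W) (v v' : K × K) :
    BilinExt.alt (mulForm q) v v' = q (v.1 * v'.2 - v'.1 * v.2) := by
  rw [BilinExt.alt_apply, mulForm_apply, mulForm_apply, map_sub]

theorem alt_mulForm_surjective {K W : Type*} [Field K] [AddCommGroup W] {q : K →+ W}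
    (hq : Function.Surjective q) {v : K × K} (hv : v ≠ 0) :
    Function.Surjective (BilinExt.alt (mulForm q) v) := by
  intro w
  obtain ⟨c, rfl⟩ := hq w
  by_cases h1 : v.1 = 0
  · have h2 : v.2 ≠ 0 := fun h2 => hv (Prod.ext h1 h2)
    exact ⟨(-(c / v.2), 0), by rw [alt_mulForm_apply]; field_simp; simp⟩
  · exact ⟨(0, c / v.1), by rw [alt_mulForm_apply]; field_simp; simp⟩

/-- All the groups with form `q (a b')` have type `(b, d)`, where `p ^ d` and `p ^ b` are the orders
of the source and the target of `q`: the commutators with any noncentral element fill the center,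
and `a = 0` defines a maximal isotropic subgroup. -/
theorem mulForm_isStemPGroupOfType {p b d : ℕ} [Fact p.Prime] {K W : Type*} [Field K]
    [AddCommGroup W] (q : K →+ W) (hq : Function.Surjective q) (hK : Nat.card K = p ^ d)
    (hW : Nat.card W = p ^ b) (hb : 1 ≤ b) :
    IsStemPGroupOfType p (BilinExt (mulForm q)) b d ∧
      Subgroup.center (BilinExt (mulForm q)) = (BilinExt.proj (mulForm q)).ker ∧
      commutator (BilinExt (mulForm q)) = (BilinExt.proj (mulForm q)).ker ∧
      Nat.card (BilinExt (mulForm q)) = p ^ (2 * d + b) := by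
  have hp : p.Prime := Fact.out
  have hfinK : Finite K := Nat.finite_of_card_ne_zero (hK ▸ pow_ne_zero _ hp.ne_zero)
  have hfinW : Finite W := Nat.finite_of_card_ne_zero (hW ▸ pow_ne_zero _ hp.ne_zero)
  have : Nontrivial W := Finite.one_lt_card_iff_nontrivial.1
    (hW ▸ Nat.one_lt_pow (by omega) hp.one_lt)
  have hd : d ≠ 0 := by
    rintro rfl
    exact (Finite.one_lt_card (α := K)).ne' (by rw [hK, pow_zero])
  obtain ⟨w₀, hw₀⟩ := exists_ne (0 : W)
  obtain ⟨ψ, hψ⟩ := AddChar.exists_apply_ne_zero.2 hw₀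
  obtain ⟨c₀, rfl⟩ := hq w₀
  have hne : ((1, 0) : K × K) ≠ 0 := fun h => one_ne_zero (congrArg Prod.fst h)
  have := BilinExt.isStemPGroupOfType (mulForm q) (m := 2 * d) (n := b)
    (by rw [Nat.card_prod, hK, two_mul, pow_add]) hW hb (by omega)
    (fun v hv => by
      rw [AddMonoidHom.range_eq_top.2 (alt_mulForm_surjective hq hv), AddSubgroup.card_top, hW])
    (by
      rw [eq_top_iff]
      intro w _
      obtain ⟨v, hv⟩ := alt_mulForm_surjective hq hne w
      exact AddSubgroup.subset_closure ⟨_, v, hv⟩)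
    (AddMonoidHom.fst K K) Prod.fst_surjective
    (by rw [hK, Nat.mul_div_cancel_left _ (by norm_num)]) ψ
    (fun a b ha _ => by
      rw [mulForm_apply, show a.1 = 0 from ha, zero_mul, map_zero, ψ.map_zero_eq_one])
    (fun v hv => by
      by_contra hv1
      change v.1 ≠ 0 at hv1
      refine hψ ?_
      have := hv (0, c₀ / v.1) rfl
      rwa [alt_mulForm_apply, zero_mul, sub_zero, mul_div_cancel₀ _ hv1] at this)
  rwa [Nat.mul_div_cancel_left _ (by norm_num : 0 < 2)] at this

/-- In a group of class at most two, a maximal subgroup `M` contains the derived subgroup: if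
`M Z(G) = G`, then the commutators of `G` are those of `M`. -/
theorem IsCoatom.commutator_le_of_class_two {G : Type*} [Group G] {M : Subgroup G}
    (hM : IsCoatom M) (hG : commutator G ≤ Subgroup.center G) : commutator G ≤ M := by
  rcases hM.le_iff.1 (le_sup_left : M ≤ M ⊔ Subgroup.center G) with h | h
  · rw [commutator_def, Subgroup.commutator_le]
    have hdecomp : ∀ x : G, ∃ m ∈ M, ∃ z ∈ Subgroup.center G, m * z = x := fun x =>
      Subgroup.mem_sup_of_normal_right.1 (h ▸ Subgroup.mem_top x)
    intro x _ y _
    obtain ⟨m, hm, z, hz, rfl⟩ := hdecomp x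
    obtain ⟨n, hn, w, hw, rfl⟩ := hdecomp y
    have hz' := Subgroup.mem_center_iff.1 hz
    have hw' := Subgroup.mem_center_iff.1 hw
    have : ⁅m * z, n * w⁆ = ⁅m, n⁆ := by
      rw [commutatorElement_def, commutatorElement_def, mul_inv_rev, mul_inv_rev]
      calc m * z * (n * w) * (z⁻¹ * m⁻¹) * (w⁻¹ * n⁻¹)
          = m * (z * (n * w)) * z⁻¹ * m⁻¹ * w⁻¹ * n⁻¹ := by group
        _ = m * n * w * m⁻¹ * w⁻¹ * n⁻¹ := by rw [← hz']; group
        _ = m * n * (m⁻¹ * w) * w⁻¹ * n⁻¹ := by rw [hw' m⁻¹]; group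
        _ = m * n * m⁻¹ * n⁻¹ := by group
    rw [this, commutatorElement_def]
    exact M.mul_mem (M.mul_mem (M.mul_mem hm hn) (M.inv_mem hm)) (M.inv_mem hn)
  · exact hG.trans (sup_eq_left.1 h)

/-- The Heisenberg group over `𝔽_p` is extraspecial; its Frattini subgroup is the intersection of
the maximal subgroups `a = 0` and `b = 0`. -/
theorem heisenberg_isExtraspecial (p : ℕ) [Fact p.Prime] :
    IsExtraspecial p (BilinExt (mulForm (AddMonoidHom.id (ZMod p)))) ∧
      Nat.card (BilinExt (mulForm (AddMonoidHom.id (ZMod p)))) = p ^ 3 := by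
  have hK : Nat.card (ZMod p) = p ^ 1 := by rw [Nat.card_zmod, pow_one]
  obtain ⟨htype, hcenter, hcomm, hcard⟩ := mulForm_isStemPGroupOfType
    (AddMonoidHom.id (ZMod p)) Function.surjective_id hK hK le_rfl
  refine ⟨⟨htype.finite, htype.isPGroup, ?_, hcomm.trans hcenter.symm, le_antisymm ?_ ?_⟩, hcard⟩
  · have h1 := (Subgroup.center (BilinExt (mulForm (AddMonoidHom.id (ZMod p))))).card_mul_index
    have hp : p.Prime := Fact.out
    have h2 : (Subgroup.center (BilinExt (mulForm (AddMonoidHom.id (ZMod p))))).index = p * p := by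
      rw [hcenter, Subgroup.index_ker, MonoidHom.range_eq_top.2 (BilinExt.proj_surjective _),
        Subgroup.card_top]
      exact (Nat.card_prod _ _).trans (by rw [Nat.card_zmod])
    rw [h2, hcard] at h1
    exact Nat.eq_of_mul_eq_mul_right (Nat.mul_pos hp.pos hp.pos)
      (h1.trans (by ring))
  · intro x hx
    have hcoatom : ∀ L : ZMod p × ZMod p →+ ZMod p, Function.Surjective L → L x.fst = 0 := by
      intro L hL
      have hsurj : Function.Surjective ((AddMonoidHom.toMultiplicative L).comp
          (BilinExt.proj (mulForm (AddMonoidHom.id (ZMod p))))) :=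
        Function.Surjective.comp (g := AddMonoidHom.toMultiplicative L) hL
          (BilinExt.proj_surjective _)
      refine frattini_le_coatom (Subgroup.isCoatom_of_index_eq_prime (p := p)
        (A := ((AddMonoidHom.toMultiplicative L).comp (BilinExt.proj _)).ker) ?_) hx
      rw [Subgroup.index_ker, MonoidHom.range_eq_top.2 hsurj, Subgroup.card_top]
      exact Nat.card_zmod p
    rw [hcenter, BilinExt.mem_ker_proj]
    exact Prod.ext (hcoatom (AddMonoidHom.fst _ _) Prod.fst_surjective)
      (hcoatom (AddMonoidHom.snd _ _) Prod.snd_surjective)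
  · rw [hcenter, ← hcomm, frattini, Order.radical]
    exact le_iInf₂ fun M hM => hM.commutator_le_of_class_two (hcomm.trans hcenter.symm).le

section UT3

variable {K : Type*} [Field K]

/-- The unitriangular matrix with entries `a`, `b` above the diagonal and `c` in the corner. -/
def UT3.mk (a b c : K) : UT3 K :=
  ⟨{ val := !![1, a, c; 0, 1, b; 0, 0, 1]
     inv := !![1, -a, a * b - c; 0, 1, -b; 0, 0, 1]
     val_inv := by
      ext i j
      fin_cases i <;> fin_cases j <;> simp [Matrix.mul_apply, Fin.sum_univ_three]
      all_goals ring
     inv_val := by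
      ext i j
      fin_cases i <;> fin_cases j <;> simp [Matrix.mul_apply, Fin.sum_univ_three]
      all_goals ring },
    ⟨fun i j h => by fin_cases i <;> fin_cases j <;> simp_all,
      fun i => by fin_cases i <;> simp⟩⟩

/-- The entry of a unitriangular matrix at the position `(i, j)`. -/
def UT3.entry (A : UT3 K) (i j : Fin 3) : K := A.1.val i j

theorem UT3.entry_mul (A B : UT3 K) :
    UT3.entry (A * B) 0 1 = UT3.entry A 0 1 + UT3.entry B 0 1 ∧
    UT3.entry (A * B) 1 2 = UT3.entry A 1 2 + UT3.entry B 1 2 ∧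
    UT3.entry (A * B) 0 2 =
      UT3.entry A 0 2 + UT3.entry B 0 2 + UT3.entry A 0 1 * UT3.entry B 1 2 := by
  have hA := A.2.2
  have hB := B.2.2
  have hA1 := A.2.1 1 0 (by decide)
  have hB1 := B.2.1 2 1 (by decide)
  have h : ∀ i j, UT3.entry (A * B) i j = ∑ k, A.1.val i k * B.1.val k j := fun _ _ => rfl
  rw [h, h, h]
  simp only [Fin.sum_univ_three, hA, hB, hA1, hB1, UT3.entry]
  refine ⟨?_, ?_, ?_⟩ <;> ring

theorem UT3.ext_entry {A B : UT3 K} (h1 : UT3.entry A 0 1 = UT3.entry B 0 1)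
    (h2 : UT3.entry A 1 2 = UT3.entry B 1 2) (h3 : UT3.entry A 0 2 = UT3.entry B 0 2) :
    A = B := by
  refine Subtype.ext (Units.ext (Matrix.ext fun i j => ?_))
  rcases lt_trichotomy i j with h | rfl | h
  · fin_cases i <;> fin_cases j <;> first | exact h1 | exact h2 | exact h3 | exact absurd h (by decide)
  · rw [A.2.2, B.2.2]
  · rw [A.2.1 i j h, B.2.1 i j h]

theorem UT3.entry_mk (a b c : K) : UT3.entry (UT3.mk a b c) 0 1 = a ∧
    UT3.entry (UT3.mk a b c) 1 2 = b ∧ UT3.entry (UT3.mk a b c) 0 2 = c := ⟨rfl, rfl, rfl⟩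

/-- The isomorphism onto the extension with form `a b'`, followed by a map of the corner entry. -/
def UT3.toBilinExt {W : Type*} [AddCommGroup W] (q : K →+ W) :
    UT3 K →* BilinExt (mulForm q) where
  toFun A := ⟨(UT3.entry A 0 1, UT3.entry A 1 2), q (UT3.entry A 0 2)⟩
  map_one' := by
    ext
    · rfl
    · rfl
    · exact map_zero q
  map_mul' A B := by
    obtain ⟨h1, h2, h3⟩ := UT3.entry_mul A B
    ext
    · exact h1
    · exact h2
    · rw [BilinExt.snd_mul, mulForm_apply, ← map_add, ← map_add]
      exact congrArg q h3

theorem UT3.toBilinExt_surjective {W : Type*} [AddCommGroup W] {q : K →+ W}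
    (hq : Function.Surjective q) : Function.Surjective (UT3.toBilinExt q) := by
  rintro ⟨⟨a, b⟩, w⟩
  obtain ⟨c, rfl⟩ := hq w
  exact ⟨UT3.mk a b c, rfl⟩

/-- The embedding of the corner entry. -/
def UT3.corner (K : Type*) [Field K] : Multiplicative K →* UT3 K where
  toFun c := UT3.mk 0 0 c.toAdd
  map_one' := UT3.ext_entry rfl rfl rfl
  map_mul' c c' := by
    obtain ⟨h1, h2, h3⟩ := UT3.entry_mul (UT3.mk 0 0 c.toAdd) (UT3.mk 0 0 c'.toAdd)
    refine UT3.ext_entry ?_ ?_ ?_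
    · rw [h1]
      exact (add_zero 0).symm
    · rw [h2]
      exact (add_zero 0).symm
    · rw [h3]
      simp only [UT3.entry_mk, zero_mul, add_zero, toAdd_mul]

theorem UT3.corner_injective : Function.Injective (UT3.corner K) := fun _ _ h =>
  Multiplicative.toAdd.injective (congrArg (fun A => UT3.entry A 0 2) h)

theorem UT3.range_corner : (UT3.corner K).range = Subgroup.center (UT3 K) := by
  ext A
  rw [Subgroup.mem_center_iff]
  constructor
  · rintro ⟨c, rfl⟩ B
    obtain ⟨h1, h2, h3⟩ := UT3.entry_mul B (UT3.corner K c)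
    obtain ⟨k1, k2, k3⟩ := UT3.entry_mul (UT3.corner K c) B
    have e1 : UT3.entry (UT3.corner K c) 0 1 = 0 := rfl
    have e2 : UT3.entry (UT3.corner K c) 1 2 = 0 := rfl
    refine UT3.ext_entry ?_ ?_ ?_
    · rw [h1, k1, add_comm]
    · rw [h2, k2, add_comm]
    · rw [h3, k3, e1, e2]
      ring
  · intro h
    have hcomm : ∀ B : UT3 K,
        UT3.entry A 0 1 * UT3.entry B 1 2 = UT3.entry B 0 1 * UT3.entry A 1 2 := by
      intro B
      have h1 := (UT3.entry_mul A B).2.2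
      have h2 := (UT3.entry_mul B A).2.2
      rw [← h B] at h1
      linear_combination h2 - h1
    have e1 := hcomm (UT3.mk 0 1 0)
    have e2 := hcomm (UT3.mk 1 0 0)
    simp only [UT3.entry_mk, mul_one, zero_mul, mul_zero, one_mul] at e1 e2
    exact ⟨Multiplicative.ofAdd (UT3.entry A 0 2), UT3.ext_entry e1.symm e2 rfl⟩

/-- Under `UT3.corner`, a central subgroup `N` corresponds to an additive subgroup of the field, and
the quotient by `N` to the extension with form `a b'` modulo that subgroup. -/
theorem UT3.quotient_isStemPGroupOfType {p b d : ℕ} [Fact p.Prime] (hK : Nat.card K = p ^ d)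
    (hb : 1 ≤ b) (hbd : b ≤ d) (N : Subgroup (UT3 K)) [N.Normal]
    (hN : N ≤ Subgroup.center (UT3 K)) (hcard : Nat.card N = p ^ (d - b)) :
    IsStemPGroupOfType p (UT3 K ⧸ N) b d ∧ Nat.card (UT3 K ⧸ N) = p ^ (b + 2 * d) := by
  have hp : p.Prime := Fact.out
  let N' : AddSubgroup K := AddSubgroup.toSubgroup.symm (N.comap (UT3.corner K))
  have hmem : ∀ c, c ∈ N' ↔ UT3.corner K (Multiplicative.ofAdd c) ∈ N := fun _ => Iff.rfl
  have hN' : Nat.card N' = p ^ (d - b) := by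
    have h1 : (N.comap (UT3.corner K)).map (UT3.corner K) = N := by
      rw [Subgroup.map_comap_eq, UT3.range_corner, inf_eq_right.2 hN]
    rw [← hcard, ← h1, Subgroup.card_map_of_injective UT3.corner_injective]
    rfl
  have hW : Nat.card (K ⧸ N') = p ^ b := by
    have h1 := AddSubgroup.card_eq_card_quotient_mul_card_addSubgroup N'
    rw [hN', hK] at h1
    refine Nat.eq_of_mul_eq_mul_right (pow_pos hp.pos (d - b)) (h1.symm.trans ?_)
    rw [← pow_add, Nat.add_sub_cancel' hbd]
  have hq := QuotientAddGroup.mk'_surjective N'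
  obtain ⟨htype, -, -, hord⟩ := mulForm_isStemPGroupOfType _ hq hK hW hb
  have hker : (UT3.toBilinExt (QuotientAddGroup.mk' N')).ker = N := by
    ext A
    rw [MonoidHom.mem_ker]
    constructor
    · intro h
      have h1 : UT3.entry A 0 2 ∈ N' :=
        (QuotientAddGroup.eq_zero_iff _).1 (congrArg BilinExt.snd h)
      have h2 : A = UT3.corner K (Multiplicative.ofAdd (UT3.entry A 0 2)) :=
        UT3.ext_entry (congrArg (fun x => x.fst.1) h) (congrArg (fun x => x.fst.2) h) rfl
      rw [h2]
      exact (hmem _).1 h1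
    · intro h
      have h1 : A ∈ (UT3.corner K).range := UT3.range_corner.ge (hN h)
      obtain ⟨c, rfl⟩ := h1
      have h2 : c.toAdd ∈ N' := (hmem _).2 h
      refine BilinExt.ext rfl ((QuotientAddGroup.eq_zero_iff _).2 h2)
  have e : BilinExt (mulForm (QuotientAddGroup.mk' N')) ≃* UT3 K ⧸ N :=
    ((QuotientGroup.quotientMulEquivOfEq hker.symm).trans
      (QuotientGroup.quotientKerEquivOfSurjective _ (UT3.toBilinExt_surjective hq))).symm
  refine ⟨htype.of_mulEquiv e, ?_⟩
  rw [← Nat.card_congr e.toEquiv, hord, add_comm]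

theorem UT3.exists_central_subgroup {p d : ℕ} [Fact p.Prime] (hK : Nat.card K = p ^ d) {k : ℕ}
    (hk : k ≤ d) : ∃ N : Subgroup (UT3 K), N ≤ Subgroup.center (UT3 K) ∧ Nat.card N = p ^ k := by
  have hp : p.Prime := Fact.out
  have : Finite K := Nat.finite_of_card_ne_zero (hK ▸ pow_ne_zero _ hp.ne_zero)
  obtain ⟨M, hM⟩ := Sylow.exists_subgroup_card_pow_prime (G := Multiplicative K) p (n := k)
    (by
      rw [show Nat.card (Multiplicative K) = p ^ d from hK]
      exact pow_dvd_pow p hk)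
  refine ⟨M.map (UT3.corner K), ?_, ?_⟩
  · rw [← UT3.range_corner]
    exact Subgroup.map_le_range _ _
  · rw [Subgroup.card_map_of_injective UT3.corner_injective, hM]

end UT3

/-! ### The free group of class two and exponent `p` -/

/-- The pairs `i < j` in `Fin r`, with `j` as the first component. -/
abbrev IncreasingPair (r : ℕ) : Type := Σ j : Fin r, Fin j

/-- The larger element of a pair. -/
def IncreasingPair.hi {r : ℕ} (x : IncreasingPair r) : Fin r := x.1

/-- The smaller element of a pair. -/
def IncreasingPair.lo {r : ℕ} (x : IncreasingPair r) : Fin r := ⟨x.2, x.2.2.trans x.1.2⟩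

/-- The pair formed by `i < j`. -/
def IncreasingPair.mk {r : ℕ} {i j : Fin r} (h : i < j) : IncreasingPair r := ⟨j, ⟨i, h⟩⟩

theorem IncreasingPair.lo_lt_hi {r : ℕ} (x : IncreasingPair r) : x.lo < x.hi := x.2.2

theorem IncreasingPair.ext' {r : ℕ} {x y : IncreasingPair r} (h : x.hi = y.hi) (h' : x.lo = y.lo) :
    x = y := by
  obtain ⟨j, i⟩ := x
  obtain ⟨j', i'⟩ := y
  obtain rfl : j = j' := h
  have : (i : ℕ) = i' := congrArg (fun k : Fin r => (k : ℕ)) h'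
  rw [Fin.ext this]

theorem card_increasingPair (r : ℕ) : Fintype.card (IncreasingPair r) = r * (r - 1) / 2 := by
  rw [Fintype.card_sigma, ← Finset.sum_range_id]
  simp only [Fintype.card_fin]
  exact Fin.sum_univ_eq_sum_range (fun i => i) r

/-- The biadditive map on `𝔽_p ^ r` with components `v_i v'_j` for `i < j`. -/
def pairForm (p r : ℕ) :
    (Fin r → ZMod p) →+ (Fin r → ZMod p) →+ (IncreasingPair r → ZMod p) :=
  AddMonoidHom.mk' (fun v => AddMonoidHom.mk' (fun v' x => v x.lo * v' x.hi)
    (fun a b => by ext x; exact mul_add _ _ _))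
    (fun a b => by ext v' x; exact add_mul _ _ _)

theorem alt_pairForm_apply {p r : ℕ} (v v' : Fin r → ZMod p) (x : IncreasingPair r) :
    BilinExt.alt (pairForm p r) v v' x = v x.lo * v' x.hi - v' x.lo * v x.hi := rfl

theorem alt_pairForm_single {p r : ℕ} (x : IncreasingPair r) (c : ZMod p) :
    BilinExt.alt (pairForm p r) (Pi.single x.lo 1) (Pi.single x.hi c) = Pi.single x c := by
  ext y
  rw [alt_pairForm_apply]
  have hx := x.lo_lt_hi
  have hy := y.lo_lt_hi
  by_cases h : y = x
  · subst h
    simp [Pi.single_eq_of_ne hy.ne]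
  · rw [Pi.single_eq_of_ne h]
    by_cases h1 : y.lo = x.lo
    · have h2 : y.hi ≠ x.hi := fun h2 => h (IncreasingPair.ext' h2 h1)
      have h3 : y.lo ≠ x.hi := h1 ▸ hx.ne
      simp [Pi.single_eq_of_ne h2, Pi.single_eq_of_ne h3]
    · by_cases h3 : y.lo = x.hi
      · have h4 : y.hi ≠ x.lo := fun h4 => (hx.trans_le h3.ge).not_gt (h4 ▸ hy)
        simp [Pi.single_eq_of_ne h1, Pi.single_eq_of_ne h4]
      · simp [Pi.single_eq_of_ne h1, Pi.single_eq_of_ne h3]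

theorem addSubgroup_pi_zmod_eq_top {ι : Type*} [Fintype ι] [DecidableEq ι] {p : ℕ} [NeZero p]
    (S : AddSubgroup (ι → ZMod p)) (h : ∀ i, Pi.single i 1 ∈ S) : S = ⊤ := by
  rw [eq_top_iff]
  intro w _
  rw [← Finset.univ_sum_single w]
  refine S.sum_mem fun i _ => ?_
  have : Pi.single i (w i) = (w i).val • (Pi.single i 1 : ι → ZMod p) := by
    rw [← Pi.single_smul, nsmul_one, ZMod.natCast_zmod_val]
  rw [this]
  exact S.nsmul_mem (h i) _

/-- The kernel of `alt v` is the line spanned by `v`. -/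
theorem card_range_alt_pairForm {p b : ℕ} [Fact p.Prime] {v : Fin (b + 1) → ZMod p} (hv : v ≠ 0) :
    Nat.card (BilinExt.alt (pairForm p (b + 1)) v).range = p ^ b := by
  have hp : p.Prime := Fact.out
  obtain ⟨i₀, hi₀⟩ := Function.ne_iff.1 hv
  change v i₀ ≠ 0 at hi₀
  have hker : Nat.card (BilinExt.alt (pairForm p (b + 1)) v).ker = p := by
    refine (Nat.card_congr (Equiv.ofBijective (fun c : ZMod p =>
      (⟨c • v, ?_⟩ : (BilinExt.alt (pairForm p (b + 1)) v).ker))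
        ⟨fun c d h => ?_, ?_⟩)).symm.trans (Nat.card_zmod p)
    · rw [AddMonoidHom.mem_ker]
      ext x
      rw [alt_pairForm_apply]
      simp only [Pi.smul_apply, smul_eq_mul, Pi.zero_apply]
      ring
    · exact mul_right_cancel₀ hi₀ (congrFun (congrArg Subtype.val h) i₀)
    · rintro ⟨u, hu⟩
      have hsymm : ∀ i j, v i * u j = u i * v j := by
        have hlt : ∀ i j, i < j → v i * u j = u i * v j := fun i j hij =>
          sub_eq_zero.1 (congrFun (AddMonoidHom.mem_ker.1 hu) (IncreasingPair.mk hij))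
        intro i j
        rcases lt_trichotomy i j with h | rfl | h
        · exact hlt i j h
        · exact mul_comm _ _
        · rw [mul_comm (v i), mul_comm (u i)]
          exact (hlt j i h).symm
      refine ⟨u i₀ / v i₀, Subtype.ext (funext fun j => ?_)⟩
      change u i₀ / v i₀ * v j = u j
      rw [div_mul_eq_mul_div, ← hsymm, mul_div_cancel_left₀ _ hi₀]
  have h := (BilinExt.alt (pairForm p (b + 1)) v).ker.card_mul_index
  rw [AddSubgroup.index_ker, hker, Nat.card_fun, Nat.card_zmod, Nat.card_fin, pow_succ'] at h
  exact Nat.eq_of_mul_eq_mul_left hp.pos h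

/-- The model of the free group: with `k = ⌊r / 2⌋`, the character `w ↦ e(∑_{i < k} w_{i, k + i})`
of the center makes `v_{k + i} = 0`, for `i < k`, a maximal isotropic subspace. -/
theorem pairForm_isStemPGroupOfType (p b : ℕ) [Fact p.Prime] (hb : 1 ≤ b) :
    IsStemPGroupOfType p (BilinExt (pairForm p (b + 1))) b ((b + 1) / 2) ∧
      Subgroup.center (BilinExt (pairForm p (b + 1))) = (BilinExt.proj (pairForm p (b + 1))).ker ∧
      commutator (BilinExt (pairForm p (b + 1))) = (BilinExt.proj (pairForm p (b + 1))).ker ∧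
      Nat.card (BilinExt (pairForm p (b + 1))) = p ^ (b + 1 + (b + 1) * b / 2) := by
  classical
  have hp : p.Prime := Fact.out
  set k := (b + 1) / 2 with hk
  have h2k : 2 * k ≤ b + 1 := by omega
  let lo : Fin k → Fin (b + 1) := fun i => ⟨i, by omega⟩
  let hi : Fin k → Fin (b + 1) := fun i => ⟨k + i, by omega⟩
  have hlt : ∀ i, lo i < hi i := fun i => by
    rw [Fin.lt_def]
    change (i : ℕ) < k + i
    omega
  have hhi_inj : Function.Injective hi := fun i j h => by
    have : k + (i : ℕ) = k + j := congrArg Fin.val h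
    exact Fin.ext (by omega)
  have hlo_ne : ∀ i j, hi i ≠ lo j := fun i j h => by
    have : k + (i : ℕ) = j := congrArg Fin.val h
    omega
  let L : (Fin (b + 1) → ZMod p) →+ (Fin k → ZMod p) :=
    AddMonoidHom.mk' (fun v i => v (hi i)) fun _ _ => rfl
  have hL : Function.Surjective L := fun u => by
    refine ⟨Function.extend hi u 0, funext fun i => ?_⟩
    exact hhi_inj.extend_apply u 0 i
  let s : (IncreasingPair (b + 1) → ZMod p) →+ ZMod p :=
    AddMonoidHom.mk' (fun w => ∑ i : Fin k, w (IncreasingPair.mk (hlt i))) fun w w' => by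
      simp only [Pi.add_apply, Finset.sum_add_distrib]
  obtain ⟨e, he⟩ := AddChar.exists_apply_ne_zero.2 (one_ne_zero (α := ZMod p))
  refine BilinExt.isStemPGroupOfType (pairForm p (b + 1)) (m := b + 1) (n := (b + 1) * b / 2)
    ?_ ?_ hb (by omega) (fun v hv => card_range_alt_pairForm hv) ?_ L hL ?_
    (e.compAddMonoidHom s) (fun a c _ hc => ?_) (fun v hv => ?_)
  · rw [Nat.card_fun, Nat.card_zmod, Nat.card_fin]
  · rw [Nat.card_fun, Nat.card_zmod, Nat.card_eq_fintype_card, card_increasingPair,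
      Nat.add_sub_cancel]
  · refine addSubgroup_pi_zmod_eq_top _ fun x => AddSubgroup.subset_closure ?_
    exact ⟨_, _, alt_pairForm_single x 1⟩
  · rw [Nat.card_fun, Nat.card_zmod, Nat.card_fin]
  · have h0 : s (pairForm p (b + 1) a c) = 0 := by
      change ∑ i : Fin k, pairForm p (b + 1) a c (IncreasingPair.mk (hlt i)) = 0
      refine Finset.sum_eq_zero fun i _ => ?_
      have : c (hi i) = 0 := congrFun hc i
      exact (congrArg (a (lo i) * ·) this).trans (mul_zero _)
    rw [AddChar.compAddMonoidHom_apply, h0, e.map_zero_eq_one]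
  · refine funext fun i => ?_
    change v (hi i) = 0
    by_contra hvi
    -- test against the vector of the isotropic subspace with a single entry, at `i`
    refine he ?_
    have h1 := hv (Pi.single (lo i) (-(v (hi i))⁻¹))
      (funext fun j => Pi.single_eq_of_ne (hlo_ne j i) _)
    rw [AddChar.compAddMonoidHom_apply] at h1
    convert h1 using 2
    change 1 = ∑ j : Fin k, (v (lo j) * (Pi.single (lo i) (-(v (hi i))⁻¹) : _ → ZMod p) (hi j)
      - (Pi.single (lo i) (-(v (hi i))⁻¹) : _ → ZMod p) (lo j) * v (hi j))
    rw [Finset.sum_eq_single i]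
    · rw [Pi.single_eq_of_ne (hlo_ne i i), Pi.single_eq_same]
      field_simp
      ring
    · intro j _ hj
      have hne : lo j ≠ lo i := fun h => hj (by
        have : (j : ℕ) = i := congrArg (fun l : Fin (b + 1) => (l : ℕ)) h
        exact Fin.ext this)
      rw [Pi.single_eq_of_ne (hlo_ne j i), Pi.single_eq_of_ne hne]
      ring
    · simp

theorem lowerCentralSeries_two_eq_bot {G : Type*} [Group G]
    (hG : commutator G ≤ Subgroup.center G) : (⊤ : Subgroup G).lowerCentralSeries 2 = ⊥ := by
  rw [Subgroup.lowerCentralSeries_succ, Subgroup.top_lowerCentralSeries_one, eq_bot_iff,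
    Subgroup.commutator_le]
  intro x hx y _
  rw [Subgroup.mem_bot, commutatorElement_eq_one_iff_mul_comm]
  exact (Subgroup.mem_center_iff.1 (hG hx) y).symm

/-- Commuting elements `x i` of order dividing `p` generate a quotient of the product of the cyclic
groups that they generate. -/
theorem card_closure_le_of_commute {p : ℕ} [Fact p.Prime] {G ι : Type*} [Group G] [Fintype ι]
    (x : ι → G) (hcomm : ∀ i j, Commute (x i) (x j)) (hpow : ∀ i, x i ^ p = 1) :
    Finite (Subgroup.closure (Set.range x)) ∧
      Nat.card (Subgroup.closure (Set.range x)) ≤ p ^ Fintype.card ι := by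
  have hp : p.Prime := Fact.out
  have hc : Pairwise fun i j => ∀ a b : G,
      a ∈ Subgroup.zpowers (x i) → b ∈ Subgroup.zpowers (x j) → Commute a b := by
    rintro i j - _ _ ⟨k, rfl⟩ ⟨l, rfl⟩
    exact (hcomm i j).zpow_zpow k l
  have hfin : ∀ i, Finite (Subgroup.zpowers (x i)) := fun i =>
    finite_zpowers.2 (isOfFinOrder_iff_pow_eq_one.2 ⟨p, hp.pos, hpow i⟩)
  have hle : ∀ i, Nat.card (Subgroup.zpowers (x i)) ≤ p := fun i => by
    rw [Nat.card_zpowers]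
    exact Nat.le_of_dvd hp.pos (orderOf_dvd_of_pow_eq_one (hpow i))
  have hrange : (Subgroup.noncommPiCoprod hc).range = Subgroup.closure (Set.range x) := by
    rw [Subgroup.noncommPiCoprod_range, ← Set.iUnion_singleton_eq_range, Subgroup.closure_iUnion]
    simp only [Subgroup.zpowers_eq_closure]
  have hsurj := (Subgroup.noncommPiCoprod hc).rangeRestrict_surjective
  rw [← hrange]
  refine ⟨Finite.of_surjective _ hsurj, (Nat.card_le_card_of_surjective _ hsurj).trans ?_⟩
  rw [Nat.card_pi]
  exact (Finset.prod_le_prod' fun i _ => hle i).trans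
    (by rw [Finset.prod_const, Finset.card_univ])

/-- A group of class two and exponent `p` with `r` generators: the commutators `[x_i, x_j]` with
`i < j` generate a central subgroup with abelian quotient. -/
theorem card_le_of_class_two_of_exponent {p r : ℕ} [Fact p.Prime] {Q : Type*} [Group Q]
    (x : Fin r → Q) (hx : Subgroup.closure (Set.range x) = ⊤)
    (hQ : commutator Q ≤ Subgroup.center Q) (hpow : ∀ y : Q, y ^ p = 1) :
    Finite Q ∧ Nat.card Q ≤ p ^ (r + r * (r - 1) / 2) := by
  let c : IncreasingPair r → Q := fun y => ⁅x y.lo, x y.hi⁆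
  have hc : ∀ y, c y ∈ Subgroup.center Q := fun y =>
    hQ (Subgroup.commutator_mem_commutator (Subgroup.mem_top _) (Subgroup.mem_top _))
  obtain ⟨hfinC, hcardC⟩ := card_closure_le_of_commute (p := p) c
    (fun i j => (Subgroup.mem_center_iff.1 (hc j) (c i))) fun i => hpow _
  set C := Subgroup.closure (Set.range c) with hC
  have hCZ : C ≤ Subgroup.center Q := (Subgroup.closure_le _).2 (by
    rintro _ ⟨y, rfl⟩
    exact hc y)
  have hnormal : C.Normal := ⟨fun z hz g => by
    rw [Subgroup.mem_center_iff.1 (hCZ hz) g, mul_inv_cancel_right]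
    exact hz⟩
  have hcomm : ∀ i j, Commute (QuotientGroup.mk' C (x i)) (QuotientGroup.mk' C (x j)) := by
    have hlt : ∀ i j, i < j → Commute (QuotientGroup.mk' C (x i)) (QuotientGroup.mk' C (x j)) := by
      intro i j hij
      rw [← commutatorElement_eq_one_iff_commute, ← map_commutatorElement]
      exact (QuotientGroup.eq_one_iff _).2 (Subgroup.subset_closure ⟨IncreasingPair.mk hij, rfl⟩)
    intro i j
    rcases lt_trichotomy i j with h | rfl | h
    · exact hlt i j h
    · exact Commute.refl _
    · exact (hlt j i h).symm
  obtain ⟨hfinQ, hcardQ⟩ := card_closure_le_of_commute (p := p)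
    (fun i => QuotientGroup.mk' C (x i)) hcomm fun i => by rw [← map_pow, hpow, map_one]
  have htop : Subgroup.closure (Set.range fun i => QuotientGroup.mk' C (x i)) = ⊤ := by
    have := MonoidHom.map_closure (QuotientGroup.mk' C) (Set.range x)
    rw [hx, Subgroup.map_top_of_surjective _ (QuotientGroup.mk'_surjective C),
      ← Set.range_comp] at this
    exact this.symm
  rw [htop] at hfinQ hcardQ
  rw [Subgroup.card_top, Fintype.card_fin] at hcardQ
  rw [card_increasingPair] at hcardC
  have hfin : Finite (Q ⧸ C) := Subgroup.topEquiv.symm.toEquiv.finite_iff.2 hfinQ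
  have hmul := Subgroup.card_eq_card_quotient_mul_card_subgroup C
  refine ⟨Nat.finite_of_card_ne_zero (by
    rw [hmul]
    exact mul_ne_zero Nat.card_pos.ne' Nat.card_pos.ne'), ?_⟩
  rw [hmul, pow_add]
  exact Nat.mul_le_mul hcardQ hcardC

namespace FreeClassTwoQuot

variable (p r : ℕ)

theorem commutator_le_center :
    commutator (FreeClassTwoQuot p r) ≤ Subgroup.center (FreeClassTwoQuot p r) := by
  intro z hz
  rw [Subgroup.mem_center_iff]
  intro y
  have h1 : ⁅z, y⁆ ∈ (⊤ : Subgroup (FreeClassTwoQuot p r)).lowerCentralSeries 2 :=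
    Subgroup.commutator_mem_commutator hz (Subgroup.mem_top y)
  have h2 : (⊤ : Subgroup (FreeClassTwoQuot p r)).lowerCentralSeries 2 = ⊥ := by
    rw [← Subgroup.map_top_of_surjective _ (QuotientGroup.mk'_surjective _),
      ← Subgroup.map_lowerCentralSeries, Subgroup.map_eq_bot_iff, QuotientGroup.ker_mk']
    exact le_sup_left
  rw [h2, Subgroup.mem_bot, commutatorElement_eq_one_iff_mul_comm] at h1
  exact h1.symm

theorem pow_eq_one (y : FreeClassTwoQuot p r) : y ^ p = 1 := by
  obtain ⟨y, rfl⟩ := QuotientGroup.mk_surjective y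
  rw [← QuotientGroup.mk_pow, QuotientGroup.eq_one_iff]
  exact le_sup_right (a := (⊤ : Subgroup (FreeGroup (Fin r))).lowerCentralSeries 2)
    (Subgroup.subset_closure ⟨y, rfl⟩)

theorem closure_range_of :
    Subgroup.closure (Set.range fun i => (QuotientGroup.mk (FreeGroup.of i) :
      FreeClassTwoQuot p r)) = ⊤ := by
  have := MonoidHom.map_closure (QuotientGroup.mk' ((⊤ : Subgroup
    (FreeGroup (Fin r))).lowerCentralSeries 2 ⊔ powSubgroup (FreeGroup (Fin r)) p))
    (Set.range FreeGroup.of)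
  rw [FreeGroup.closure_range_of, Subgroup.map_top_of_surjective _
    (QuotientGroup.mk'_surjective _), ← Set.range_comp] at this
  exact this.symm

variable [Fact p.Prime]

theorem pairForm_pow_eq_one (hodd : Odd p) (y : BilinExt (pairForm p r)) : y ^ p = 1 := by
  have hp : p.Prime := Fact.out
  have h2 : p ∣ p.choose 2 := hp.dvd_choose_self two_ne_zero
    (lt_of_le_of_ne hp.two_le fun h => absurd (h ▸ hodd) (by decide))
  obtain ⟨m, hm⟩ := h2
  rw [BilinExt.pow_eq, hm]
  ext i
  · simp
  · simp

/-- The homomorphism from the free group onto the model. -/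
def toBilinExt : FreeGroup (Fin r) →* BilinExt (pairForm p r) :=
  FreeGroup.lift fun i => ⟨Pi.single i 1, 0⟩

theorem toBilinExt_surjective : Function.Surjective (toBilinExt p r) := by
  rw [← MonoidHom.range_eq_top, eq_top_iff]
  have hgen : ∀ i, (⟨Pi.single i 1, 0⟩ : BilinExt (pairForm p r)) ∈ (toBilinExt p r).range :=
    fun i => ⟨FreeGroup.of i, FreeGroup.lift_apply_of⟩
  have hW : AddSubgroup.toSubgroup.symm
      ((toBilinExt p r).range.comap (BilinExt.incl (pairForm p r))) = ⊤ := by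
    refine addSubgroup_pi_zmod_eq_top _ fun x => ?_
    change BilinExt.incl (pairForm p r) (Multiplicative.ofAdd (Pi.single x 1)) ∈
      (toBilinExt p r).range
    have h1 := BilinExt.commutatorElement_eq (pairForm p r) ⟨Pi.single x.lo 1, 0⟩
      ⟨Pi.single x.hi 1, 0⟩
    rw [alt_pairForm_single] at h1
    change (⟨0, Pi.single x 1⟩ : BilinExt (pairForm p r)) ∈ _
    rw [← h1, commutatorElement_def]
    exact Subgroup.mul_mem _ (Subgroup.mul_mem _ (Subgroup.mul_mem _ (hgen _) (hgen _))
      (Subgroup.inv_mem _ (hgen _))) (Subgroup.inv_mem _ (hgen _))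
  have hV : AddSubgroup.toSubgroup.symm
      ((toBilinExt p r).range.map (BilinExt.proj (pairForm p r))) = ⊤ :=
    addSubgroup_pi_zmod_eq_top _ fun i => ⟨_, hgen i, rfl⟩
  intro x _
  obtain ⟨y, hy, hyx⟩ : x.fst ∈ AddSubgroup.toSubgroup.symm
      ((toBilinExt p r).range.map (BilinExt.proj (pairForm p r))) := hV ▸ AddSubgroup.mem_top _
  have hw : (x * y⁻¹).snd ∈ AddSubgroup.toSubgroup.symm
      ((toBilinExt p r).range.comap (BilinExt.incl (pairForm p r))) := hW ▸ AddSubgroup.mem_top _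
  have hyx' : y.fst = x.fst := hyx
  have h1 : x * y⁻¹ = BilinExt.incl (pairForm p r) (Multiplicative.ofAdd (x * y⁻¹).snd) :=
    BilinExt.ext (by
      rw [BilinExt.fst_mul, BilinExt.fst_inv, hyx', add_neg_cancel]
      rfl) rfl
  have h2 : x * y⁻¹ ∈ (toBilinExt p r).range := by
    rw [h1]
    exact hw
  simpa using Subgroup.mul_mem _ h2 hy

/-- The surjection onto the model is an isomorphism, because the source is no larger than the
target. -/
theorem nonempty_mulEquiv (hodd : Odd p) :
    Nonempty (BilinExt (pairForm p r) ≃* FreeClassTwoQuot p r) := by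
  have hp : p.Prime := Fact.out
  have hcomm : commutator (BilinExt (pairForm p r)) ≤ Subgroup.center (BilinExt (pairForm p r)) := by
    rw [commutator_def, Subgroup.commutator_le]
    intro x _ y _
    rw [BilinExt.commutatorElement_eq, BilinExt.mem_center_iff]
    exact map_zero _
  have hker : (⊤ : Subgroup (FreeGroup (Fin r))).lowerCentralSeries 2 ⊔
      powSubgroup (FreeGroup (Fin r)) p ≤ (toBilinExt p r).ker := by
    refine sup_le ?_ ((Subgroup.closure_le _).2 ?_)
    · rw [← Subgroup.map_eq_bot_iff, Subgroup.map_lowerCentralSeries,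
        Subgroup.map_top_of_surjective _ (toBilinExt_surjective p r),
        lowerCentralSeries_two_eq_bot hcomm]
    · rintro _ ⟨y, rfl⟩
      rw [SetLike.mem_coe, MonoidHom.mem_ker, map_pow]
      exact pairForm_pow_eq_one p r hodd _
  have hsurj : Function.Surjective (QuotientGroup.lift _ (toBilinExt p r) hker) :=
    QuotientGroup.lift_surjective_of_surjective _ _ (toBilinExt_surjective p r) hker
  obtain ⟨hfin, hle⟩ := card_le_of_class_two_of_exponent (p := p)
    (fun i => (QuotientGroup.mk (FreeGroup.of i) : FreeClassTwoQuot p r)) (closure_range_of p r)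
    (commutator_le_center p r) (pow_eq_one p r)
  have hcard : Nat.card (BilinExt (pairForm p r)) = p ^ (r + r * (r - 1) / 2) := by
    rw [BilinExt.card_eq, Nat.card_fun, Nat.card_fun, Nat.card_zmod, Nat.card_fin,
      Nat.card_eq_fintype_card, card_increasingPair, pow_add]
  have hbij := hsurj.bijective_of_nat_card_le (hle.trans hcard.ge)
  exact ⟨(MulEquiv.ofBijective _ hbij).symm⟩

end FreeClassTwoQuot

theorem FreeClassTwoQuot.isStemPGroupOfType {p b : ℕ} [Fact p.Prime] (hodd : Odd p) (hb : 1 ≤ b) :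
    IsStemPGroupOfType p (FreeClassTwoQuot p (b + 1)) b ((b + 1) / 2) ∧
      commutator (FreeClassTwoQuot p (b + 1)) = Subgroup.center (FreeClassTwoQuot p (b + 1)) ∧
      Nat.card (commutator (FreeClassTwoQuot p (b + 1))) = p ^ (b * (b + 1) / 2) ∧
      Nat.card (FreeClassTwoQuot p (b + 1)) = p ^ ((b ^ 2 + 3 * b + 2) / 2) := by
  have hp : p.Prime := Fact.out
  obtain ⟨e⟩ := FreeClassTwoQuot.nonempty_mulEquiv p (b + 1) hodd
  obtain ⟨htype, hcenter, hcomm, hcard⟩ := pairForm_isStemPGroupOfType p b hb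
  refine ⟨htype.of_mulEquiv e, ?_, ?_, ?_⟩
  · rw [← map_commutator_mulEquiv e, ← map_center_mulEquiv e, hcenter, hcomm]
  · rw [← map_commutator_mulEquiv e, Subgroup.card_map_of_injective e.injective]
    have h1 := (commutator (BilinExt (pairForm p (b + 1)))).card_mul_index
    have h2 : (commutator (BilinExt (pairForm p (b + 1)))).index = p ^ (b + 1) := by
      rw [hcomm, Subgroup.index_ker, MonoidHom.range_eq_top.2 (BilinExt.proj_surjective _),
        Subgroup.card_top]
      exact Nat.card_fun.trans (by rw [Nat.card_zmod, Nat.card_fin])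
    rw [h2, hcard, pow_add p (b + 1) ((b + 1) * b / 2), mul_comm (p ^ (b + 1))] at h1
    rw [mul_comm b]
    exact Nat.eq_of_mul_eq_mul_right (pow_pos hp.pos _) h1
  · rw [← Nat.card_congr e.toEquiv, hcard]
    congr 1
    have : b ^ 2 + 3 * b + 2 = (b + 1) * b + 2 * (b + 1) := by ring
    rw [this, Nat.add_mul_div_left _ _ two_pos, add_comm]

/-! ### Lower bounds for the size of a type -/

theorem IsStemPGroupOfType.le_sizeOfType {p b d b' d' n : ℕ} {G : Type} [Group G]
    (h : IsStemPGroupOfType p G b' d') (hb : b' ≤ b) (hd : d' ≤ d) (hn : Nat.card G = p ^ n) :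
    (p : ℕ∞) ^ n ≤ sizeOfType p b d :=
  le_sSup ⟨G, inferInstance, b', hb, d', hd, h, by rw [hn, Nat.cast_pow]⟩

theorem MQuot_prod_isStemPGroupOfType {p b d : ℕ} [Fact p.Prime] (hd : 1 ≤ d) (hdb : d ≤ b)
    (E : Fin (d - 1) → Type) [∀ j, Group (E j)]
    (hE : ∀ j, IsExtraspecial p (E j) ∧ Nat.card (E j) = p ^ 3) :
    IsStemPGroupOfType p (MQuot p (b - d + 3) × (∀ j, E j)) b d ∧
      Nat.card (MQuot p (b - d + 3) × (∀ j, E j)) = p ^ (b + 2 * d) := by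
  constructor
  · have h := (MQuot.isStemMonomial p (b - d)).prod
      (IsStemMonomial.pi fun j => (hE j).1.isStemMonomial (hE j).2)
    simp only [Finset.sum_const, Finset.card_univ, Fintype.card_fin, smul_eq_mul, mul_one] at h
    rw [show b - d + 1 + (d - 1) = b by omega, show 1 + (d - 1) = d by omega] at h
    exact h.isStemPGroupOfType
  · rw [Nat.card_prod, Nat.card_pi, Finset.prod_congr rfl fun j _ => (hE j).2, Finset.prod_const,
      Finset.card_univ, Fintype.card_fin, MQuot.card_eq p (b - d + 1), ← pow_mul, ← pow_add]
    congr 1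
    omega

theorem pow_le_sizeOfType (p : ℕ) [Fact p.Prime] {b d : ℕ} (hb : 1 ≤ b) (hd : 1 ≤ d) :
    (p : ℕ∞) ^ (b + 2 * d) ≤ sizeOfType p b d := by
  rcases le_or_gt d b with hdb | hbd
  · obtain ⟨h, hcard⟩ := MQuot_prod_isStemPGroupOfType hd hdb
      (fun _ => BilinExt (mulForm (AddMonoidHom.id (ZMod p)))) fun _ => heisenberg_isExtraspecial p
    exact h.le_sizeOfType le_rfl le_rfl hcard
  · have hK : Nat.card (GaloisField p d) = p ^ d := GaloisField.card p d (by omega)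
    obtain ⟨N, hN, hNcard⟩ := UT3.exists_central_subgroup hK (Nat.sub_le d b)
    have : N.Normal := ⟨fun z hz g => by
      rw [Subgroup.mem_center_iff.1 (hN hz) g, mul_inv_cancel_right]
      exact hz⟩
    obtain ⟨h, hcard⟩ := UT3.quotient_isStemPGroupOfType hK hb hbd.le N hN hNcard
    exact h.le_sizeOfType le_rfl le_rfl hcard

theorem iSup_eq_top_of_pow_le {p : ℕ} (hp : 1 < p) (f : ℕ → ℕ∞)
    (hf : ∀ n, 1 ≤ n → (p : ℕ∞) ^ n ≤ f n) : (⨆ (n : ℕ) (_ : 1 ≤ n), f n) = ⊤ := by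
  refine ENat.eq_top_iff_forall_ge.2 fun m => ?_
  refine le_trans ?_ (le_iSup₂_of_le (m + 1) (Nat.le_add_left 1 m) (hf _ (Nat.le_add_left 1 m)))
  rw [← Nat.cast_pow, Nat.cast_le]
  exact ((Nat.le_succ m).trans (Nat.lt_pow_self hp).le)
theorem mainTheorem2 (p : ℕ) [Fact p.Prime] :
    -- the lower bound and its consequence
    (∀ b d : ℕ, 1 ≤ b → 1 ≤ d → (p : ℕ∞) ^ (b + 2 * d) ≤ sizeOfType p b d) ∧
    (∀ d : ℕ, 1 ≤ d → (⨆ (s : ℕ) (_ : 1 ≤ s), sizeOfType p s d) = ⊤) ∧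
    (∀ b : ℕ, 1 ≤ b → (⨆ (t : ℕ) (_ : 1 ≤ t), sizeOfType p b t) = ⊤) ∧
    -- the quotients of maximal class
    (∀ i : ℕ, 3 ≤ i → IsStemPGroupOfType p (MQuot p i) (i - 2) 1 ∧
      Nat.card (MQuot p i) = p ^ i ∧ Group.nilpotencyClass (MQuot p i) = i - 1) ∧
    -- the witnesses for `d ≤ b`
    (∃ (E : Type) (_ : Group E), IsExtraspecial p E ∧ Nat.card E = p ^ 3) ∧
    (∀ b d : ℕ, 1 ≤ d → d ≤ b → ∀ (E : Fin (d - 1) → Type) [∀ j, Group (E j)],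
      (∀ j, IsExtraspecial p (E j) ∧ Nat.card (E j) = p ^ 3) →
      IsStemPGroupOfType p (MQuot p (b - d + 3) × (∀ j, E j)) b d ∧
        Nat.card (MQuot p (b - d + 3) × (∀ j, E j)) = p ^ (b + 2 * d)) ∧
    -- the witnesses for `b < d`
    (∀ b d : ℕ, 1 ≤ b → b < d →
      (∃ N : Subgroup (UT3 (GaloisField p d)),
        N ≤ Subgroup.center (UT3 (GaloisField p d)) ∧ Nat.card N = p ^ (d - b)) ∧
      ∀ (N : Subgroup (UT3 (GaloisField p d))) [N.Normal],
        N ≤ Subgroup.center (UT3 (GaloisField p d)) → Nat.card N = p ^ (d - b) →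
        IsStemPGroupOfType p (UT3 (GaloisField p d) ⧸ N) b d ∧
          Nat.card (UT3 (GaloisField p d) ⧸ N) = p ^ (b + 2 * d)) ∧
    -- the case of odd `p`
    (Odd p →
      (∀ b : ℕ, 1 ≤ b →
        IsStemPGroupOfType p (FreeClassTwoQuot p (b + 1)) b ((b + 1) / 2) ∧
        commutator (FreeClassTwoQuot p (b + 1)) =
          Subgroup.center (FreeClassTwoQuot p (b + 1)) ∧
        Nat.card (commutator (FreeClassTwoQuot p (b + 1))) = p ^ (b * (b + 1) / 2) ∧
        Nat.card (FreeClassTwoQuot p (b + 1)) = p ^ ((b ^ 2 + 3 * b + 2) / 2) ∧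
        (p : ℕ∞) ^ ((b ^ 2 + 3 * b + 2) / 2) ≤ sizeOfType p b ((b + 1) / 2)) ∧
      (∀ b d : ℕ, 1 ≤ b → b + 1 ≤ 2 * d →
        (p : ℕ∞) ^ ((b ^ 2 + 3 * b + 2) / 2) ≤ sizeOfType p b d) ∧
      (∀ b d : ℕ, 1 ≤ d → 2 * d ≤ b →
        (p : ℕ∞) ^ (d * (2 * d + 1)) ≤ sizeOfType p b d)) := by
  have hp : p.Prime := Fact.out
  have hpos : (1 : ℕ∞) ≤ p := by exact_mod_cast hp.one_lt.le
  refine ⟨fun b d hb hd => pow_le_sizeOfType p hb hd, fun d hd => ?_, fun b hb => ?_,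
    fun i hi => ?_, ⟨_, inferInstance, heisenberg_isExtraspecial p⟩,
    fun b d hd hdb E _ hE => MQuot_prod_isStemPGroupOfType hd hdb E hE, fun b d hb hbd => ?_,
    fun hodd => ⟨fun b hb => ?_, fun b d hb hbd => ?_, fun b d hd hdb => ?_⟩⟩
  · refine iSup_eq_top_of_pow_le hp.one_lt _ fun s hs => ?_
    exact (pow_le_pow_right₀ hpos (by omega)).trans (pow_le_sizeOfType p hs hd)
  · refine iSup_eq_top_of_pow_le hp.one_lt _ fun t ht => ?_
    exact (pow_le_pow_right₀ hpos (by omega)).trans (pow_le_sizeOfType p hb ht)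
  · obtain ⟨k, rfl⟩ := Nat.exists_eq_add_of_le' hi
    exact ⟨(MQuot.isStemMonomial p k).isStemPGroupOfType, MQuot.card_eq p (k + 1),
      MQuot.nilpotencyClass_eq p (k + 1)⟩
  · have hK : Nat.card (GaloisField p d) = p ^ d := GaloisField.card p d (by omega)
    exact ⟨UT3.exists_central_subgroup hK (Nat.sub_le d b), fun N _ hN hcard =>
      UT3.quotient_isStemPGroupOfType hK hb hbd.le N hN hcard⟩
  · obtain ⟨h, h1, h2, h3⟩ := FreeClassTwoQuot.isStemPGroupOfType hodd hb
    exact ⟨h, h1, h2, h3, h.le_sizeOfType le_rfl le_rfl h3⟩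
  · obtain ⟨h, -, -, h3⟩ := FreeClassTwoQuot.isStemPGroupOfType hodd hb
    exact h.le_sizeOfType le_rfl (by omega) h3
  · -- the free group on `2 d` generators, of type `(2 d - 1, d)`
    obtain ⟨h, -, -, h3⟩ := FreeClassTwoQuot.isStemPGroupOfType hodd
      (show 1 ≤ 2 * d - 1 by omega)
    have hexp : ((2 * d - 1) ^ 2 + 3 * (2 * d - 1) + 2) / 2 = d * (2 * d + 1) := by
      obtain ⟨c, rfl⟩ := Nat.exists_eq_add_of_le' hd
      rw [show 2 * (c + 1) - 1 = 2 * c + 1 by omega]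
      refine Nat.div_eq_of_eq_mul_right two_pos ?_
      ring
    rw [hexp] at h3
    exact h.le_sizeOfType (by omega) (by omega) h3
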